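/- A unimodal sequence of size $n$ is a sequence of positive integers with a specified part, the peak, $$\lambda_1^{[L]}\le\dots\le\lambda_r^{[L]}\le\lambda_{\mathrm{PK}}\ge\lambda_s^{[R]}\ge\dots\ge\lambda_1^{[R]},\qquad r,s\ge 0,$$ whose parts sum to $n$, i.e. $\lambda_{\mathrm{PK}}+\sum_{k=1}^r\lambda_k^{[L]}+\sum_{k=1}^s\lambda_k^{[R]}=n$ (the position of the peak is part of the data). For $n\ge1$ let $\mathbf{P}_n$ be the uniform probability measure on the finite set of unimodal sequences of size $n$, let $\mathbf{E}_n$ be expectation under $\mathbf{P}_n$, and let $\mathrm{PK}(\lambda)=\lambda_{\mathrm{PK}}$. Put $B=\frac{\sqrt3}{\pi}$. Theorem. For every $v\in\mathbb{R}$, $$\lim_{n\to\infty}\mathbf{P}_n\left(\frac{\mathrm{PK}-B\sqrt n\,\log(2B\sqrt n)}{B\sqrt n}\le v\right)=e^{-e^{-v}}.$$ Moreover, as $n\to\infty$, $$\mathbf{E}_n(\mathrm{PK})=B\sqrt n\,\log(2B\sqrt n)+B\gamma\sqrt n\,(1+o(1)),$$ where $\gamma$ is the Euler--Mascheroni constant.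 -/

import Mathlib

open Filter Topology MeasureTheory

/-- A unimodal sequence of positive integers with a specified peak,
`left₁ ≤ ⋯ ≤ left_r ≤ peak ≥ right₁ ≥ ⋯ ≥ right_s`, read from left to right.
Either side may be empty. -/
@[ext]
structure UnimodalSeq where
  /-- the parts to the left of the peak, read from left to right -/
  left : List ℕ
  /-- the peak -/
  peak : ℕ
  /-- the parts to the right of the peak, read from left to right -/
  right : List ℕ
  left_mono : left.Pairwise (fun a b => a ≤ b)
  right_anti : right.Pairwise (fun a b => b ≤ a)
  left_le_peak : ∀ a ∈ left, a ≤ peak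
  right_le_peak : ∀ a ∈ right, a ≤ peak
  left_pos : ∀ a ∈ left, 0 < a
  peak_pos : 0 < peak
  right_pos : ∀ a ∈ right, 0 < a

namespace UnimodalSeq

/-- The size of a unimodal sequence: the sum of all its parts. -/
def size (l : UnimodalSeq) : ℕ := l.left.sum + l.peak + l.right.sum

/-- Every set of unimodal sequences is an event. -/
instance instMeasurableSpace : MeasurableSpace UnimodalSeq := ⊤

/-- The set of unimodal sequences of size `n`. -/
def ofSize (n : ℕ) : Set UnimodalSeq := {l | l.size = n}

/-- The uniform probability measure on the unimodal sequences of size `n`. -/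
noncomputable def unif (n : ℕ) : Measure UnimodalSeq :=
  ProbabilityTheory.uniformOn (ofSize n)

/-- The peak, as a real random variable. -/
def PK (l : UnimodalSeq) : ℝ := (l.peak : ℝ)

theorem finite_ofSize (n : ℕ) : (ofSize n).Finite := by
  have key : ∀ l : ofSize n, ∃ c : Composition n × Fin (n + 1),
      c.1.blocks = l.1.left ++ l.1.peak :: l.1.right ∧ (c.2 : ℕ) = l.1.left.length := by
    rintro ⟨l, hl⟩
    have hl' : l.left.sum + l.peak + l.right.sum = n := hl
    have hlen : l.left.length ≤ l.left.sum :=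
      List.length_le_sum_of_one_le _ (fun a ha => l.left_pos a ha)
    refine ⟨⟨⟨l.left ++ l.peak :: l.right, ?_, ?_⟩, ⟨l.left.length, by omega⟩⟩, rfl, rfl⟩
    · intro a ha
      rcases List.mem_append.1 ha with h | h
      · exact l.left_pos a h
      · rcases List.mem_cons.1 h with h | h
        · exact h ▸ l.peak_pos
        · exact l.right_pos a h
    · simp only [List.sum_append, List.sum_cons]
      omega
  choose f hf hg using key
  have : Finite (ofSize n) := by
    refine Finite.of_injective f (fun a b hab => ?_)
    have h1 := hf a
    rw [hab, hf b] at h1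
    have h2 := hg a
    rw [hab, hg b] at h2
    obtain ⟨h3, h4⟩ := List.append_inj h1 h2
    obtain ⟨h5, h6⟩ := List.cons.inj h4
    exact Subtype.ext (UnimodalSeq.ext h3.symm h5.symm h6.symm)
  exact Set.toFinite _

theorem nonempty_ofSize {n : ℕ} (hn : 1 ≤ n) : (ofSize n).Nonempty :=
  ⟨⟨[], n, [], by simp, by simp, by simp, by simp, by simp, hn, by simp⟩,
    by simp [ofSize, size]⟩

theorem isProbabilityMeasure_unif {n : ℕ} (hn : 1 ≤ n) : IsProbabilityMeasure (unif n) :=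
  haveI : MeasurableSingletonClass UnimodalSeq := ⟨fun _ => trivial⟩
  ProbabilityTheory.isProbabilityMeasure_uniformOn (finite_ofSize n) (nonempty_ofSize hn)

/-- The constant `B = √3 / π`. -/
noncomputable def B : ℝ := √3 / Real.pi

end UnimodalSeq

/-! A unimodal sequence of size `n` with peak `m` is a pair of partitions of total size `n - m` with
parts at most `m`. Weight a part `j` by `q ^ j`, where `q = exp (-t)` and `t = temp n = 1 / (B √n)`.
The two partitions then become independent families of geometric multiplicities, and the count
becomes `pairProb`, the probability that their total size is `n - m`, divided by the explicit factor
`q ^ (n - m) ∏_{j ≤ m} (1 - q ^ j) ^ 2`.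

Let `tailProd n m = ∏_{m < j ≤ n} (1 - q ^ j) ^ 2`. Since `tailProd n m - tailProd n (m - 1) = q ^ m
* tailProd n m * (2 - q ^ m)`, the normalised number of sequences with peak `m` is an increment of
`tailProd` times the slowly varying factor `peakRatio` (`peakCount_mul_normFactor`). If this factor
is nearly a constant `c`, the distribution function of the peak is nearly `tailProd`. With `m t =
center n + v` and `exp (-center n) = t / 2`, the logarithm of `tailProd` is about `-2 ∑_{j > m} q ^
j ≈ -2 exp (-m t) / t = -exp (-v)`, which is the Gumbel law (`tendsto_tailProd_level`).

That the factor is nearly constant is a local limit theorem (`exists_tendsto_localDensity`), uniform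
over peaks with `3/4 * center n ≤ m t ≤ 2 * center n`. It comes from Fourier inversion and dominated
convergence at scale `t ^ (3/2)`. `tendsto_charFn` gives the Gaussian pointwise limit, and
`exists_norm_charFn_le` gives the integrable majorant. The choice of `t` makes the mean total size
agree with `n - m` up to `o(t ^ (-3/2))`. Peaks outside this range carry negligible mass by crude
bounds (`exists_cumWeight_sub_le`).

For the expectation, both tails of the normalised peak are `O(exp (-v))` uniformly in large `n`
(`exists_normPeak_tail_le`). The layer-cake formula and dominated convergence then give convergence
to the Gumbel mean, which is `γ` because `Γ'(1) = -γ`. -/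

namespace UnimodalSeq

/-! ### Counting unimodal sequences by their peak -/

open Finset in
/-- The number of partitions of `k` with all parts at most `m`. -/
def boundedCount (m k : ℕ) : ℕ := #(Nat.Partition.restricted k (· ≤ m))

open Finset in
/-- The number of ordered pairs of partitions of total size `k` with all parts at most `m`. -/
def pairCount (m k : ℕ) : ℕ :=
  ∑ p ∈ Finset.HasAntidiagonal.antidiagonal k, boundedCount m p.1 * boundedCount m p.2

open Finset Classical in
/-- The number of unimodal sequences of size `n` with peak `m`. -/
noncomputable def peakCount (n m : ℕ) : ℕ :=
  #((finite_ofSize n).toFinset.filter (fun l => l.peak = m))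

/-- A unimodal sequence with prescribed peak and prescribed sums on both sides amounts to
two partitions with bounded parts. -/
noncomputable def fiberEquiv {n m i j : ℕ} (hm : 1 ≤ m) (hij : i + m + j = n) :
    {l : UnimodalSeq // l.size = n ∧ l.peak = m ∧ l.left.sum = i ∧ l.right.sum = j} ≃
      (Nat.Partition.restricted i (· ≤ m)) × (Nat.Partition.restricted j (· ≤ m)) where
  toFun l :=
    (⟨⟨(l.1.left : Multiset ℕ), fun h => l.1.left_pos _ h, by simpa using l.2.2.2.1⟩,
      Finset.mem_filter.2 ⟨Finset.mem_univ _, fun a ha =>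
        (l.1.left_le_peak a ha).trans_eq l.2.2.1⟩⟩,
     ⟨⟨(l.1.right : Multiset ℕ), fun h => l.1.right_pos _ h, by simpa using l.2.2.2.2⟩,
      Finset.mem_filter.2 ⟨Finset.mem_univ _, fun a ha =>
        (l.1.right_le_peak a ha).trans_eq l.2.2.1⟩⟩)
  invFun p :=
    ⟨⟨p.1.1.parts.sort (· ≤ ·), m, p.2.1.parts.sort (· ≥ ·),
      Multiset.pairwise_sort _ _, Multiset.pairwise_sort _ _,
      fun a ha => (Finset.mem_filter.1 p.1.2).2 a (by simpa using ha),
      fun a ha => (Finset.mem_filter.1 p.2.2).2 a (by simpa using ha),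
      fun a ha => p.1.1.parts_pos (by simpa using ha), hm,
      fun a ha => p.2.1.parts_pos (by simpa using ha)⟩, by
      have h1 : (p.1.1.parts.sort (· ≤ ·)).sum = i := by
        rw [← Multiset.sum_coe, Multiset.sort_eq, p.1.1.parts_sum]
      have h2 : (p.2.1.parts.sort (· ≥ ·)).sum = j := by
        rw [← Multiset.sum_coe, Multiset.sort_eq, p.2.1.parts_sum]
      refine ⟨?_, rfl, h1, h2⟩
      simp only [size, h1, h2, hij]⟩
  left_inv l := by
    apply Subtype.ext
    apply UnimodalSeq.ext
    · refine List.Perm.eq_of_pairwise' (r := (· ≤ ·)) (UnimodalSeq.left_mono _)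
        l.1.left_mono ?_
      rw [← Multiset.coe_eq_coe, Multiset.sort_eq]
    · exact l.2.2.1.symm
    · refine List.Perm.eq_of_pairwise' (r := (· ≥ ·)) (UnimodalSeq.right_anti _)
        l.1.right_anti ?_
      rw [← Multiset.coe_eq_coe, Multiset.sort_eq]
  right_inv p := by
    refine Prod.ext (Subtype.ext (Nat.Partition.ext ?_)) (Subtype.ext (Nat.Partition.ext ?_))
    · simp
    · simp

theorem card_fiber_eq {n m i j : ℕ} (hm : 1 ≤ m) (hij : i + m + j = n) :
    Nat.card {l : UnimodalSeq // l.size = n ∧ l.peak = m ∧ l.left.sum = i ∧ l.right.sum = j} =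
      boundedCount m i * boundedCount m j := by
  rw [Nat.card_congr (fiberEquiv hm hij), Nat.card_prod]
  simp [boundedCount]

theorem peakCount_eq {n m : ℕ} (hm : 1 ≤ m) (hmn : m ≤ n) :
    peakCount n m = pairCount m (n - m) := by
  classical
  rw [peakCount, pairCount, Finset.card_eq_sum_card_fiberwise
    (f := fun l : UnimodalSeq => (l.left.sum, l.right.sum))
    (t := Finset.HasAntidiagonal.antidiagonal (n - m))]
  · refine Finset.sum_congr rfl fun p hp => ?_
    rw [Finset.HasAntidiagonal.mem_antidiagonal] at hp
    rw [← card_fiber_eq hm (show p.1 + m + p.2 = n by omega), eq_comm]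
    refine Nat.subtype_card _ fun l => ?_
    simp [ofSize, Prod.ext_iff, and_assoc]
  · intro l hl
    simp only [Finset.coe_filter, Set.Finite.mem_toFinset, ofSize, Set.mem_ofPred_eq, size] at hl
    rw [Finset.mem_coe, Finset.HasAntidiagonal.mem_antidiagonal]
    dsimp only
    omega

theorem peakCount_eq_zero {n m : ℕ} (h : m = 0 ∨ n < m) : peakCount n m = 0 := by
  classical
  rw [peakCount, Finset.card_eq_zero, Finset.filter_eq_empty_iff]
  intro l hl hlm
  have h1 := l.peak_pos
  simp only [Set.Finite.mem_toFinset, ofSize, Set.mem_ofPred_eq, size] at hl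
  omega

open Finset Classical in
theorem unif_real_peak {n : ℕ} (p : ℕ → Prop) :
    (unif n).real {l | p l.peak} =
      (∑ m ∈ (Icc 1 n).filter p, (peakCount n m : ℝ)) / ∑ m ∈ Icc 1 n, (peakCount n m : ℝ) := by
  have : MeasurableSingletonClass UnimodalSeq := ⟨fun _ => trivial⟩
  have key : ∀ p : ℕ → Prop, (Measure.count.real (ofSize n ∩ {l | p l.peak}) : ℝ) =
      ∑ m ∈ (Icc 1 n).filter p, (peakCount n m : ℝ) := by
    intro p
    have hf : (ofSize n ∩ {l | p l.peak}).Finite := (finite_ofSize n).inter_of_left _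
    rw [Measure.real, Measure.count_apply_finite _ hf, ENNReal.toReal_natCast, ← Nat.cast_sum]
    congr 1
    rw [card_eq_sum_card_fiberwise (f := fun l : UnimodalSeq => l.peak)
      (t := (Icc 1 n).filter p)]
    · refine sum_congr rfl fun m hm => ?_
      rw [peakCount]
      congr 1
      ext l
      simp only [mem_filter, Set.Finite.mem_toFinset, Set.mem_inter_iff, Set.mem_ofPred_eq]
      have := (mem_filter.1 hm).2
      constructor
      · rintro ⟨⟨h1, h2⟩, h3⟩
        exact ⟨h1, h3⟩
      · rintro ⟨h1, h3⟩
        exact ⟨⟨h1, h3 ▸ this⟩, h3⟩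
    · intro l hl
      have h1 := l.peak_pos
      simp only [Set.Finite.coe_toFinset, ofSize, Set.mem_inter_iff, Set.mem_ofPred_eq, size] at hl
      simp only [coe_filter, mem_Icc, Set.mem_ofPred_eq]
      exact ⟨by omega, hl.2⟩
  have h2 := key (fun _ => True)
  simp only [Set.ofPred_true, Set.inter_univ, Finset.filter_true] at h2
  rw [← key p, ← h2, unif, ProbabilityTheory.uniformOn, Measure.real,
    ProbabilityTheory.cond_apply (finite_ofSize n).measurableSet, ENNReal.toReal_mul,
    ENNReal.toReal_inv, div_eq_inv_mul, Measure.real, Measure.real]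

/-! ### Generating functions and coefficient extraction -/

open PowerSeries in
/-- The power series `f` converges absolutely at `z`, with sum `v`. -/
def EvalsTo (f : PowerSeries ℂ) (z v : ℂ) : Prop :=
  Summable (fun n => ‖coeff n f * z ^ n‖) ∧ ∑' n, coeff n f * z ^ n = v

open PowerSeries in
theorem EvalsTo.mul {f g : PowerSeries ℂ} {z v w : ℂ} (hf : EvalsTo f z v) (hg : EvalsTo g z w) :
    EvalsTo (f * g) z (v * w) := by
  have key : ∀ n, coeff n (f * g) * z ^ n = ∑ p ∈ Finset.HasAntidiagonal.antidiagonal n,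
      (coeff p.1 f * z ^ p.1) * (coeff p.2 g * z ^ p.2) := by
    intro n
    rw [coeff_mul, Finset.sum_mul]
    refine Finset.sum_congr rfl fun p hp => ?_
    rw [← Finset.HasAntidiagonal.mem_antidiagonal.1 hp, pow_add]
    ring
  have h1 := summable_norm_sum_mul_antidiagonal_of_summable_norm
    (f := fun n => coeff n f * z ^ n) (g := fun n => coeff n g * z ^ n) hf.1 hg.1
  have h2 := tsum_mul_tsum_eq_tsum_sum_antidiagonal_of_summable_norm
    (f := fun n => coeff n f * z ^ n) (g := fun n => coeff n g * z ^ n) hf.1 hg.1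
  have key' := funext key
  refine ⟨?_, ?_⟩
  · exact h1.congr fun n => by rw [key n]
  · rw [key', ← h2, hf.2, hg.2]

open PowerSeries in
theorem evalsTo_one (z : ℂ) : EvalsTo 1 z 1 := by
  have h : ∀ n, n ≠ 0 → coeff n (1 : PowerSeries ℂ) * z ^ n = 0 := fun n hn => by
    simp [coeff_one, hn]
  refine ⟨?_, ?_⟩
  · exact summable_of_ne_finset_zero (s := {0}) fun n hn => by
      rw [h n (by simpa using hn), norm_zero]
  · rw [tsum_eq_single 0 h]
    simp

theorem evalsTo_prod {ι : Type*} (s : Finset ι) (f : ι → PowerSeries ℂ) (z : ℂ) (v : ι → ℂ)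
    (h : ∀ i ∈ s, EvalsTo (f i) z (v i)) : EvalsTo (∏ i ∈ s, f i) z (∏ i ∈ s, v i) := by
  classical
  induction s using Finset.induction_on with
  | empty => simpa using evalsTo_one z
  | insert a s ha ih =>
    rw [Finset.prod_insert ha, Finset.prod_insert ha]
    exact (h a (Finset.mem_insert_self _ _)).mul
      (ih fun i hi => h i (Finset.mem_insert_of_mem hi))

open PowerSeries PowerSeries.WithPiTopology in
theorem coeff_tsum_X_pow {d : ℕ} (hd : 0 < d) (n : ℕ) :
    coeff n (∑' j : ℕ, (X : PowerSeries ℂ) ^ (d * j)) = if d ∣ n then 1 else 0 := by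
  have hs : Summable fun j : ℕ => (X : PowerSeries ℂ) ^ (d * j) := by
    simp_rw [pow_mul]
    exact summable_pow_of_constantCoeff_eq_zero (by simp [hd.ne'])
  rw [hs.map_tsum _ (continuous_coeff _ _)]
  simp_rw [coeff_X_pow]
  split_ifs with h
  · obtain ⟨k, rfl⟩ := h
    rw [tsum_eq_single k]
    · simp
    · intro j hj
      rw [if_neg]
      intro h
      exact hj (Nat.eq_of_mul_eq_mul_left hd h).symm
  · refine (tsum_congr fun j => ?_).trans tsum_zero
    rw [if_neg]
    rintro rfl
    exact h ⟨j, rfl⟩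

/-- The power series `∑ X ^ (d * j)`. -/
noncomputable def geomSeries (d : ℕ) : PowerSeries ℂ :=
  PowerSeries.mk fun n => if d ∣ n then 1 else 0

theorem evalsTo_geomSeries {d : ℕ} (hd : 0 < d) {z : ℂ} (hz : ‖z‖ < 1) :
    EvalsTo (geomSeries d) z (1 - z ^ d)⁻¹ := by
  have hzd : ‖z ^ d‖ < 1 := by
    rw [norm_pow]
    exact pow_lt_one₀ (norm_nonneg _) hz hd.ne'
  simp_rw [EvalsTo, geomSeries, PowerSeries.coeff_mk]
  refine ⟨?_, ?_⟩
  · refine Summable.of_nonneg_of_le (fun _ => norm_nonneg _) (fun n => ?_)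
      (summable_geometric_of_lt_one (norm_nonneg _) hz)
    split_ifs
    · simp
    · simp
  · rw [← tsum_geometric_of_norm_lt_one hzd]
    have hinj : Function.Injective fun j : ℕ => d * j := fun a b h =>
      Nat.eq_of_mul_eq_mul_left hd h
    rw [← hinj.tsum_eq]
    · simp [pow_mul]
    · intro n hn
      by_contra h
      apply hn
      dsimp only
      rw [if_neg, zero_mul]
      rintro ⟨k, rfl⟩
      exact h ⟨k, rfl⟩

-- Euler's product for restricted partitions has trivial factors beyond `m`, so the infinite product
-- is finite. Its topological geometric sums are identified with `geomSeries` coefficient by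
-- coefficient.
open PowerSeries PowerSeries.WithPiTopology in
theorem mk_boundedCount (m : ℕ) :
    PowerSeries.mk (fun n => (boundedCount m n : ℂ)) =
      ∏ j ∈ Finset.Icc 1 m, geomSeries j := by
  have h1 := Nat.Partition.hasProd_powerSeriesMk_card_restricted ℂ (· ≤ m)
  have h2 : HasProd (fun i ↦ if i + 1 ≤ m then ∑' j : ℕ, (X : PowerSeries ℂ) ^ ((i + 1) * j) else 1)
      (∏ i ∈ Finset.range m, if i + 1 ≤ m then ∑' j : ℕ, (X : PowerSeries ℂ) ^ ((i + 1) * j)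
        else 1) := by
    apply hasProd_prod_of_ne_finset_one
    intro b hb
    rw [if_neg]
    simpa [Nat.succ_le_iff] using hb
  have h3 := h1.unique h2
  simp only [boundedCount]
  rw [h3, Finset.range_eq_Ico, Finset.prod_Ico_add'
    (fun i => if i ≤ m then ∑' j : ℕ, (X : PowerSeries ℂ) ^ (i * j) else 1)]
  refine Finset.prod_congr (by ext; simp) fun j hj => ?_
  rw [Finset.mem_Icc] at hj
  rw [if_pos hj.2]
  ext n
  rw [coeff_tsum_X_pow hj.1, geomSeries, coeff_mk]

open PowerSeries in
theorem evalsTo_pairCount (m : ℕ) {z : ℂ} (hz : ‖z‖ < 1) :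
    EvalsTo (PowerSeries.mk fun n => (pairCount m n : ℂ)) z
      (∏ j ∈ Finset.Icc 1 m, ((1 - z ^ j)⁻¹) ^ 2) := by
  have h : (PowerSeries.mk fun n => (pairCount m n : ℂ)) =
      PowerSeries.mk (fun n => (boundedCount m n : ℂ)) *
        PowerSeries.mk (fun n => (boundedCount m n : ℂ)) := by
    ext n
    rw [coeff_mul]
    simp [pairCount]
  rw [h, mk_boundedCount, Finset.prod_pow, sq]
  have := evalsTo_prod (Finset.Icc 1 m) geomSeries z
    (fun j => (1 - z ^ j)⁻¹) fun j hj => evalsTo_geomSeries (Finset.mem_Icc.1 hj).1 hz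
  exact this.mul this

theorem integral_exp_int (k : ℤ) :
    ∫ θ in (-Real.pi)..Real.pi, Complex.exp (k * θ * Complex.I) =
      if k = 0 then (2 * Real.pi : ℂ) else 0 := by
  split_ifs with h
  · simp [h]
    ring
  · have hk : (k : ℂ) * Complex.I ≠ 0 := mul_ne_zero (by exact_mod_cast h) Complex.I_ne_zero
    have h1 := integral_exp_mul_complex (a := -Real.pi) (b := Real.pi) hk
    have h2 : ∀ θ : ℝ, (k : ℂ) * θ * Complex.I = k * Complex.I * θ := fun θ => by ring
    simp_rw [h2, h1]
    rw [div_eq_zero_iff]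
    left
    rw [sub_eq_zero, Complex.exp_eq_exp_iff_exists_int]
    exact ⟨k, by push_cast; ring⟩

/-- Coefficient extraction on the circle of radius `q`. -/
theorem integral_evalsTo (c : ℕ → ℝ) (q : ℝ) (F : ℝ → ℂ)
    (hF : ∀ θ : ℝ, EvalsTo (PowerSeries.mk fun n => (c n : ℂ))
      (q * Complex.exp (θ * Complex.I)) (F θ)) (k : ℕ) :
    ∫ θ in (-Real.pi)..Real.pi, F θ * Complex.exp (-(k * θ * Complex.I)) =
      (2 * Real.pi * c k * q ^ k : ℂ) := by
  have hterm : ∀ (n : ℕ) (θ : ℝ), (c n : ℂ) * (q * Complex.exp (θ * Complex.I)) ^ n *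
      Complex.exp (-(k * θ * Complex.I)) =
      c n * q ^ n * Complex.exp (((n - k : ℤ) : ℂ) * θ * Complex.I) := by
    intro n θ
    rw [mul_pow, ← Complex.exp_nat_mul, mul_assoc, mul_assoc, ← Complex.exp_add, ← mul_assoc]
    congr 2
    push_cast
    ring
  have hs := (hF 0).1
  simp only [PowerSeries.coeff_mk] at hs
  have hs' : Summable fun n => ‖(c n : ℂ) * q ^ n‖ := by simpa using hs
  have h1 : HasSum (fun n : ℕ => ∫ θ in (-Real.pi)..Real.pi,
      c n * q ^ n * Complex.exp (((n - k : ℤ) : ℂ) * θ * Complex.I))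
      (∫ θ in (-Real.pi)..Real.pi, F θ * Complex.exp (-(k * θ * Complex.I))) := by
    apply intervalIntegral.hasSum_integral_of_dominated_convergence
      (bound := fun n _ => ‖(c n : ℂ) * q ^ n‖)
    · intro n
      exact (by fun_prop : Continuous _).aestronglyMeasurable
    · intro n
      refine ae_of_all _ fun θ _ => ?_
      rw [norm_mul]
      refine mul_le_of_le_one_right (norm_nonneg _) (le_of_eq ?_)
      have := Complex.norm_exp_ofReal_mul_I (((n - k : ℤ) : ℝ) * θ)
      push_cast at this ⊢
      exact this
    · exact ae_of_all _ fun _ _ => hs'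
    · exact intervalIntegrable_const
    · refine ae_of_all _ fun θ _ => ?_
      have h2 := (hF θ).1.of_norm.hasSum
      rw [(hF θ).2] at h2
      simp only [PowerSeries.coeff_mk] at h2
      have h3 := h2.mul_right (Complex.exp (-(k * θ * Complex.I)))
      simpa only [hterm] using h3
  rw [← h1.tsum_eq, tsum_eq_single k]
  · rw [intervalIntegral.integral_const_mul, integral_exp_int]
    simp
    ring
  · intro n hn
    rw [intervalIntegral.integral_const_mul, integral_exp_int, if_neg, mul_zero]
    omega

/-! ### Characteristic function of the total size: inversion and decay -/

/-- The characteristic function of the normalised total size of two independent random partitions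
with parts at most `m`, with parameter `q`. -/
noncomputable def charFn (q : ℝ) (m : ℕ) (θ : ℝ) : ℂ :=
  ∏ j ∈ Finset.Icc 1 m,
    ((1 - (q : ℂ) ^ j) / (1 - (q : ℂ) ^ j * Complex.exp (j * θ * Complex.I))) ^ 2

/-- The probability that two independent random partitions with parts at most `m`, with
parameter `q`, have total size `k`. -/
noncomputable def pairProb (q : ℝ) (m k : ℕ) : ℝ :=
  pairCount m k * q ^ k * ∏ j ∈ Finset.Icc 1 m, (1 - q ^ j) ^ 2

theorem integral_charFn {q : ℝ} (hq0 : 0 < q) (hq1 : q < 1) (m k : ℕ) :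
    ∫ θ in (-Real.pi)..Real.pi, charFn q m θ * Complex.exp (-(k * θ * Complex.I)) =
      ((2 * Real.pi * pairProb q m k : ℝ) : ℂ) := by
  have h := integral_evalsTo (fun n => (pairCount m n : ℝ)) q
    (fun θ => ∏ j ∈ Finset.Icc 1 m, ((1 - (q * Complex.exp (θ * Complex.I)) ^ j)⁻¹) ^ 2)
    (fun θ => by
      have := evalsTo_pairCount m (z := q * Complex.exp (θ * Complex.I)) (by
        rw [norm_mul, Complex.norm_exp_ofReal_mul_I, mul_one, Complex.norm_real,
          Real.norm_of_nonneg hq0.le]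
        exact hq1)
      simpa using this) k
  have h2 : ∀ θ : ℝ, charFn q m θ = (∏ j ∈ Finset.Icc 1 m, (1 - (q : ℂ) ^ j) ^ 2) *
      ∏ j ∈ Finset.Icc 1 m, ((1 - (q * Complex.exp (θ * Complex.I)) ^ j)⁻¹) ^ 2 := by
    intro θ
    rw [charFn, ← Finset.prod_mul_distrib]
    refine Finset.prod_congr rfl fun j _ => ?_
    rw [mul_pow, ← Complex.exp_nat_mul, div_eq_mul_inv, mul_pow, ← mul_assoc (j : ℂ)]
  simp_rw [h2, mul_assoc (∏ j ∈ Finset.Icc 1 m, (1 - (q : ℂ) ^ j) ^ 2)]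
  rw [intervalIntegral.integral_const_mul, h, pairProb]
  push_cast
  ring

theorem normSq_one_sub_mul_exp (r α : ℝ) :
    ‖(1 : ℂ) - r * Complex.exp (α * Complex.I)‖ ^ 2 =
      (1 - r) ^ 2 + 4 * r * Real.sin (α / 2) ^ 2 := by
  rw [← Complex.normSq_eq_norm_sq, Complex.exp_mul_I, Complex.normSq_apply]
  have h1 : Real.cos α = 1 - 2 * Real.sin (α / 2) ^ 2 := by
    have := Real.cos_two_mul (α / 2)
    rw [show 2 * (α / 2) = α by ring] at this
    rw [this, Real.cos_sq']
    ring
  have h2 := Real.sin_sq_add_cos_sq α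
  simp only [← Complex.ofReal_cos, ← Complex.ofReal_sin, Complex.sub_re, Complex.one_re,
    Complex.mul_re, Complex.ofReal_re, Complex.add_re, Complex.I_re, Complex.ofReal_im,
    Complex.I_im, Complex.sub_im, Complex.one_im, Complex.mul_im, Complex.add_im]
  ring_nf
  rw [show Real.sin α ^ 2 = 1 - Real.cos α ^ 2 by linarith, h1]
  ring_nf

theorem norm_charFn (q : ℝ) (m : ℕ) (θ : ℝ) :
    ‖charFn q m θ‖ = ∏ j ∈ Finset.Icc 1 m,
      (1 - q ^ j) ^ 2 / ((1 - q ^ j) ^ 2 + 4 * q ^ j * Real.sin (j * θ / 2) ^ 2) := by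
  rw [charFn, norm_prod]
  refine Finset.prod_congr rfl fun j _ => ?_
  have h := normSq_one_sub_mul_exp (q ^ j) (j * θ)
  push_cast at h
  rw [norm_pow, norm_div, div_pow, h]
  congr 1
  rw [← Complex.ofReal_one, ← Complex.ofReal_pow, ← Complex.ofReal_sub, Complex.norm_real,
    Real.norm_eq_abs, sq_abs]

/-- Factors with `j > N` are at most `1` and are dropped. For `j t ≤ 1` one has `1 - q ^ j ≤ j t`
and `4 q ^ j ≥ 4 / e ≥ 1`, which removes `q` from the remaining factors. -/
theorem norm_charFn_le_prod {t : ℝ} (ht : 0 < t) {N m : ℕ} (hNm : N ≤ m) (hN : N * t ≤ 1)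
    (θ : ℝ) : ‖charFn (Real.exp (-t)) m θ‖ ≤
      ∏ j ∈ Finset.Icc 1 N, (1 + Real.sin (j * θ / 2) ^ 2 / (j * t) ^ 2)⁻¹ := by
  rw [norm_charFn]
  have hsub : Finset.Icc 1 N ⊆ Finset.Icc 1 m := Finset.Icc_subset_Icc_right hNm
  rw [← Finset.prod_sdiff hsub]
  have hr : ∀ j : ℕ, 0 < Real.exp (-t) ^ j := fun j => pow_pos (Real.exp_pos _) _
  have hr1 : ∀ j : ℕ, 1 ≤ j → Real.exp (-t) ^ j < 1 := fun j hj =>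
    pow_lt_one₀ (Real.exp_pos _).le (Real.exp_lt_one_iff.2 (by linarith)) (by omega)
  have hpos : ∀ j : ℕ, 0 ≤ (1 - Real.exp (-t) ^ j) ^ 2 / ((1 - Real.exp (-t) ^ j) ^ 2 +
      4 * Real.exp (-t) ^ j * Real.sin (j * θ / 2) ^ 2) := fun j => by
    have := hr j
    positivity
  refine (mul_le_of_le_one_left (Finset.prod_nonneg fun j _ => hpos j) ?_).trans ?_
  · refine Finset.prod_le_one (fun j _ => hpos j) fun j hj => ?_
    have h0 := hr j
    refine div_le_one_of_le₀ (le_add_of_nonneg_right (by positivity)) (by positivity)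
  · refine Finset.prod_le_prod (fun j _ => hpos j) fun j hj => ?_
    rw [Finset.mem_Icc] at hj
    have hj0 : (0 : ℝ) < j := by exact_mod_cast hj.1
    have hjt : j * t ≤ 1 := le_trans
      (mul_le_mul_of_nonneg_right (by exact_mod_cast hj.2) ht.le) hN
    have hjt0 : 0 < j * t := by positivity
    have h0 := hr j
    have h1 := hr1 j hj.1
    have hexp : Real.exp (-t) ^ j = Real.exp (-(j * t)) := by
      rw [← Real.exp_nat_mul]; congr 1; ring
    have h2 : 1 - Real.exp (-t) ^ j ≤ j * t := by
      rw [hexp]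
      linarith [Real.add_one_le_exp (-(j * t))]
    have h3 : 1 / 4 ≤ Real.exp (-t) ^ j := by
      rw [hexp]
      have : Real.exp (-1) ≤ Real.exp (-(j * t)) := Real.exp_le_exp.2 (by linarith)
      have := Real.exp_neg_one_gt_d9
      linarith
    have hs : 0 ≤ Real.sin (j * θ / 2) ^ 2 := sq_nonneg _
    have h5 : 0 < 1 - Real.exp (-t) ^ j := by linarith
    rw [← one_div, div_le_div_iff₀ (by positivity) (by positivity), mul_add, mul_one, one_mul]
    refine add_le_add le_rfl ?_
    rw [mul_div_assoc', div_le_iff₀ (by positivity)]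
    have h6 : (1 - Real.exp (-t) ^ j) ^ 2 ≤ (j * t) ^ 2 := by gcongr
    have h7 : Real.sin (j * θ / 2) ^ 2 ≤ 4 * Real.exp (-t) ^ j * Real.sin (j * θ / 2) ^ 2 :=
      le_mul_of_one_le_left hs (by linarith)
    calc (1 - Real.exp (-t) ^ j) ^ 2 * Real.sin (j * θ / 2) ^ 2
        ≤ (j * t) ^ 2 * (4 * Real.exp (-t) ^ j * Real.sin (j * θ / 2) ^ 2) := by gcongr
      _ = _ := by ring

theorem norm_charFn_le_one {q : ℝ} (hq0 : 0 < q) (m : ℕ) (θ : ℝ) :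
    ‖charFn q m θ‖ ≤ 1 := by
  rw [norm_charFn]
  refine Finset.prod_le_one (fun j _ => by positivity) fun j hj => ?_
  exact div_le_one_of_le₀ (le_add_of_nonneg_right (by positivity)) (by positivity)

theorem sq_mul_sq_le_sin_sq {y : ℝ} (hy : |y| ≤ Real.pi / 2) :
    (2 / Real.pi * y) ^ 2 ≤ Real.sin y ^ 2 := by
  rw [← sq_abs (Real.sin y), ← sq_abs (2 / Real.pi * y), abs_mul, abs_of_pos (by positivity)]
  gcongr
  exact Real.mul_abs_le_abs_sin hy

/-- Here `|j θ / 2| ≤ π / 2`, so Jordan's inequality bounds every factor by the same quantity, free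
of `j`. Bernoulli's inequality turns its `N`-th power into a linear expression. -/
theorem norm_charFn_le_of_small {t : ℝ} (ht : 0 < t) {N m : ℕ} (hNm : N ≤ m) (hN : N * t ≤ 1)
    {θ : ℝ} (hθ : |θ| ≤ Real.pi * t) :
    ‖charFn (Real.exp (-t)) m θ‖ ≤ (1 + N * (θ ^ 2 / (Real.pi * t) ^ 2))⁻¹ := by
  refine (norm_charFn_le_prod ht hNm hN θ).trans ?_
  have hpi := Real.pi_pos
  have h1 : ∏ j ∈ Finset.Icc 1 N, (1 + Real.sin (j * θ / 2) ^ 2 / (j * t) ^ 2)⁻¹ ≤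
      ∏ j ∈ Finset.Icc 1 N, (1 + θ ^ 2 / (Real.pi * t) ^ 2)⁻¹ := by
    refine Finset.prod_le_prod (fun j _ => by positivity) fun j hj => ?_
    rw [Finset.mem_Icc] at hj
    have hj0 : (0 : ℝ) < j := by exact_mod_cast hj.1
    have hjt : j * t ≤ 1 := le_trans
      (mul_le_mul_of_nonneg_right (by exact_mod_cast hj.2) ht.le) hN
    have h2 : |j * θ / 2| ≤ Real.pi / 2 := by
      rw [abs_div, abs_mul, abs_of_pos hj0, abs_two]
      gcongr
      calc j * |θ| ≤ j * (Real.pi * t) := by gcongr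
        _ = Real.pi * (j * t) := by ring
        _ ≤ Real.pi := mul_le_of_le_one_right hpi.le hjt
    have h3 := sq_mul_sq_le_sin_sq h2
    gcongr ?_⁻¹
    gcongr 1 + ?_
    rw [div_le_div_iff₀ (by positivity) (by positivity)]
    calc θ ^ 2 * (j * t) ^ 2 = (2 / Real.pi * (j * θ / 2)) ^ 2 * (Real.pi * t) ^ 2 := by
          field_simp
      _ ≤ _ := by gcongr
  refine h1.trans ?_
  rw [Finset.prod_const, Nat.card_Icc, Nat.add_sub_cancel, inv_pow]
  gcongr ?_⁻¹
  refine one_add_mul_le_pow ?_ N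
  have : 0 ≤ θ ^ 2 / (Real.pi * t) ^ 2 := by positivity
  linarith

theorem two_mul_sin_mul_sum_cos (θ : ℝ) (N : ℕ) :
    2 * Real.sin (θ / 2) * ∑ j ∈ Finset.Icc 1 N, Real.cos (j * θ) =
      Real.sin ((N + 1 / 2) * θ) - Real.sin (θ / 2) := by
  induction N with
  | zero => simp; ring_nf
  | succ N ih =>
    rw [Finset.sum_Icc_succ_top (by omega), mul_add, ih]
    have h1 : Real.sin (((N + 1 : ℕ) + 1 / 2) * θ) =
        Real.sin (((N + 1 : ℕ) : ℝ) * θ) * Real.cos (θ / 2) +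
          Real.cos (((N + 1 : ℕ) : ℝ) * θ) * Real.sin (θ / 2) := by
      rw [← Real.sin_add]; ring_nf
    have h2 : Real.sin ((N + 1 / 2) * θ) =
        Real.sin (((N + 1 : ℕ) : ℝ) * θ) * Real.cos (θ / 2) -
          Real.cos (((N + 1 : ℕ) : ℝ) * θ) * Real.sin (θ / 2) := by
      rw [← Real.sin_sub]; push_cast; ring_nf
    rw [h1, h2]
    ring

/-- Writing `sin²` through the cosine leaves a Dirichlet sum `S`. Since `sin (θ / 2) ≥ θ / π`, the
condition on `N` gives `(N + 1) sin (θ / 2) ≥ 1`, and the closed form of the sum then yields `S ≤ N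
/ 2`. -/
theorem sum_sin_sq_ge {θ : ℝ} (hθ0 : 0 < θ) (hθ : θ ≤ Real.pi) {N : ℕ}
    (hN : Real.pi ≤ (N + 1) * θ) :
    (N : ℝ) / 4 ≤ ∑ j ∈ Finset.Icc 1 N, Real.sin (j * θ / 2) ^ 2 := by
  have hpi := Real.pi_pos
  have h1 : ∑ j ∈ Finset.Icc 1 N, Real.sin (j * θ / 2) ^ 2 =
      N / 2 - (∑ j ∈ Finset.Icc 1 N, Real.cos (j * θ)) / 2 := by
    have : ∀ j : ℕ, Real.sin (j * θ / 2) ^ 2 = 1 / 2 - Real.cos (j * θ) / 2 := fun j => by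
      rw [Real.sin_sq_eq_half_sub]
      ring_nf
    simp_rw [this]
    rw [Finset.sum_sub_distrib, Finset.sum_const, Nat.card_Icc, Finset.sum_div]
    simp
    ring
  have hs : θ / Real.pi ≤ Real.sin (θ / 2) := by
    have := Real.mul_le_sin (x := θ / 2) (by linarith) (by linarith)
    calc θ / Real.pi = 2 / Real.pi * (θ / 2) := by field_simp
      _ ≤ _ := this
  have hs0 : 0 < Real.sin (θ / 2) := lt_of_lt_of_le (by positivity) hs
  have h2 := two_mul_sin_mul_sum_cos θ N
  set S := ∑ j ∈ Finset.Icc 1 N, Real.cos (j * θ)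
  have h3 : 2 * Real.sin (θ / 2) * S ≤ 1 - Real.sin (θ / 2) := by
    rw [h2]
    linarith [Real.sin_le_one ((N + 1 / 2) * θ)]
  have h4 : 1 ≤ (N + 1) * Real.sin (θ / 2) := by
    calc (1 : ℝ) ≤ (N + 1) * (θ / Real.pi) := by
          rw [mul_div_assoc', le_div_iff₀ hpi]; linarith
      _ ≤ _ := by gcongr
  have h5 : 2 * Real.sin (θ / 2) * S ≤ Real.sin (θ / 2) * N := by nlinarith
  have h6 : 2 * S ≤ N := by
    refine le_of_mul_le_mul_left ?_ hs0
    linarith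
  rw [h1]
  linarith

theorem charFn_abs (q : ℝ) (m : ℕ) (θ : ℝ) : ‖charFn q m |θ|‖ = ‖charFn q m θ‖ := by
  rw [norm_charFn, norm_charFn]
  refine Finset.prod_congr rfl fun j _ => ?_
  rcases abs_cases θ with ⟨h, _⟩ | ⟨h, _⟩ <;> rw [h]
  rw [mul_neg, neg_div, Real.sin_neg, neg_sq]

/-- Concavity in the form `2 ^ s ≤ 1 + s` for `0 ≤ s ≤ 1` converts the product into `2` raised to a
sum of `sin²`, which is at least `N / 4`. -/
theorem norm_charFn_le_of_large {t : ℝ} (ht : 0 < t) {N m : ℕ} (hNm : N ≤ m) (hN : N * t ≤ 1)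
    (hN' : 1 ≤ (N + 1) * t) {θ : ℝ} (hθ : Real.pi * t ≤ |θ|) (hθ' : |θ| ≤ Real.pi) :
    ‖charFn (Real.exp (-t)) m θ‖ ≤ ((2 : ℝ) ^ ((N : ℝ) / 4))⁻¹ := by
  have hpi := Real.pi_pos
  rw [← charFn_abs]
  set φ := |θ|
  have hφ : 0 < φ := lt_of_lt_of_le (by positivity) hθ
  refine (norm_charFn_le_prod ht hNm hN φ).trans ?_
  rw [Finset.prod_inv_distrib]
  gcongr ?_⁻¹
  have h1 := sum_sin_sq_ge hφ hθ' (N := N) (by nlinarith)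
  calc (2 : ℝ) ^ ((N : ℝ) / 4)
      ≤ (2 : ℝ) ^ (∑ j ∈ Finset.Icc 1 N, Real.sin (j * φ / 2) ^ 2) :=
        Real.rpow_le_rpow_of_exponent_le (by norm_num) h1
    _ = ∏ j ∈ Finset.Icc 1 N, (2 : ℝ) ^ (Real.sin (j * φ / 2) ^ 2) :=
        Real.rpow_sum_of_pos (by norm_num) _ _
    _ ≤ _ := by
        refine Finset.prod_le_prod (fun j _ => by positivity) fun j hj => ?_
        rw [Finset.mem_Icc] at hj
        have hj0 : (0 : ℝ) < j := by exact_mod_cast hj.1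
        have hjt : j * t ≤ 1 := le_trans
          (mul_le_mul_of_nonneg_right (by exact_mod_cast hj.2) ht.le) hN
        have h2 := rpow_one_add_le_one_add_mul_self (s := 1) (by norm_num)
          (sq_nonneg (Real.sin (j * φ / 2))) (Real.sin_sq_le_one _)
        rw [mul_one] at h2
        norm_num at h2
        refine h2.trans ?_
        gcongr 1 + ?_
        rw [le_div_iff₀ (by positivity)]
        exact mul_le_of_le_one_right (sq_nonneg _) (pow_le_one₀ (by positivity) hjt)

/-- After the substitution `θ = t ^ (3/2) x` the right side is `C / (1 + x ^ 2)`, an integrable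
majorant independent of `t` and `m`. The product is cut at `N = ⌊1 / t⌋`, and the two frequency
ranges meet at `|θ| = π t`. -/
theorem exists_norm_charFn_le : ∃ C : ℝ, 0 < C ∧ ∀ t : ℝ, 0 < t → t ≤ 1 → ∀ m : ℕ, 1 ≤ m * t →
    ∀ θ : ℝ, |θ| ≤ Real.pi → ‖charFn (Real.exp (-t)) m θ‖ ≤ C * (1 + θ ^ 2 / t ^ 3)⁻¹ := by
  have hpi := Real.pi_pos
  have hpi3 := Real.pi_gt_three
  -- Since `N ≥ 1 / (2 t)`, this `a` gives `2 ^ (N / 4) ≥ exp (a / t)`, and `exp y ≥ y ^ 3 / 6` then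
  -- produces the factor `t ^ 3`.
  set a := Real.log 2 / 8
  have ha : 0 < a := by
    have := Real.log_pos (one_lt_two)
    positivity
  refine ⟨2 * Real.pi ^ 2 + (1 + Real.pi ^ 2) * (6 / a ^ 3), by positivity, ?_⟩
  intro t ht ht1 m hm θ hθ
  set N := ⌊1 / t⌋₊
  have hN : N * t ≤ 1 := by
    rw [← le_div_iff₀ ht]
    exact Nat.floor_le (by positivity)
  have hN1 : 1 < (N + 1) * t := by
    rw [← div_lt_iff₀ ht]
    exact Nat.lt_floor_add_one _
  have hN2 : 1 ≤ N * t * 2 := by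
    have h1 : 1 ≤ N := Nat.le_floor (by rw [Nat.cast_one, le_div_iff₀ ht]; linarith)
    have h2 : (1 : ℝ) ≤ N := by exact_mod_cast h1
    nlinarith
  have hNm : N ≤ m := by
    have h1 : 1 / t ≤ m := by rw [div_le_iff₀ ht]; exact hm
    exact_mod_cast (Nat.floor_le (by positivity : 0 ≤ 1 / t)).trans h1
  have hY : 0 ≤ θ ^ 2 / t ^ 3 := by positivity
  rcases le_total |θ| (Real.pi * t) with h | h
  · refine (norm_charFn_le_of_small ht hNm hN h).trans ?_
    have h1 : (1 + N * (θ ^ 2 / (Real.pi * t) ^ 2))⁻¹ ≤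
        2 * Real.pi ^ 2 * (1 + θ ^ 2 / t ^ 3)⁻¹ := by
      rw [← div_eq_mul_inv, ← one_div, div_le_div_iff₀ (by positivity) (by positivity), one_mul]
      have h2 : θ ^ 2 / t ^ 3 ≤ 2 * Real.pi ^ 2 * (N * (θ ^ 2 / (Real.pi * t) ^ 2)) := by
        have : 2 * Real.pi ^ 2 * (N * (θ ^ 2 / (Real.pi * t) ^ 2)) =
            (N * t * 2) * (θ ^ 2 / t ^ 3) := by
          field_simp
        rw [this]
        exact le_mul_of_one_le_left hY hN2
      nlinarith
    refine h1.trans ?_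
    gcongr
    exact le_add_of_nonneg_right (by positivity)
  · refine (norm_charFn_le_of_large ht hNm hN hN1.le h hθ).trans ?_
    have h1 : ((2 : ℝ) ^ ((N : ℝ) / 4))⁻¹ ≤ 6 * t ^ 3 / a ^ 3 := by
      have h2 : a / t ≤ Real.log 2 * (N / 4) := by
        have : a / t = Real.log 2 / 8 * (1 / t) := by ring
        rw [this]
        have h3 : 1 / t ≤ N * 2 := by
          rw [div_le_iff₀ ht]; linarith
        have := Real.log_pos (one_lt_two)
        nlinarith
      have h4 : (a / t) ^ 3 / 6 ≤ (2 : ℝ) ^ ((N : ℝ) / 4) := by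
        rw [Real.rpow_def_of_pos (by norm_num)]
        refine le_trans ?_ (Real.exp_le_exp.2 h2)
        have := Real.pow_div_factorial_le_exp (a / t) (by positivity) 3
        norm_num [Nat.factorial] at this ⊢
        exact this
      calc ((2 : ℝ) ^ ((N : ℝ) / 4))⁻¹ ≤ ((a / t) ^ 3 / 6)⁻¹ := by gcongr
        _ = _ := by field_simp
    have h2 : (1 + Real.pi ^ 2) * (6 / a ^ 3) * (1 + θ ^ 2 / t ^ 3)⁻¹ ≤
      (2 * Real.pi ^ 2 + (1 + Real.pi ^ 2) * (6 / a ^ 3)) * (1 + θ ^ 2 / t ^ 3)⁻¹ := by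
      gcongr
      exact le_add_of_nonneg_left (by positivity)
    refine h1.trans (le_trans ?_ h2)
    rw [← div_eq_mul_inv, le_div_iff₀ (by positivity)]
    have h3 : t ^ 3 * (1 + θ ^ 2 / t ^ 3) ≤ 1 + Real.pi ^ 2 := by
      have : t ^ 3 * (1 + θ ^ 2 / t ^ 3) = t ^ 3 + θ ^ 2 := by field_simp
      rw [this]
      have h5 : t ^ 3 ≤ 1 := pow_le_one₀ ht.le ht1
      have h6 : θ ^ 2 ≤ Real.pi ^ 2 := by rw [← sq_abs]; gcongr
      linarith
    calc 6 * t ^ 3 / a ^ 3 * (1 + θ ^ 2 / t ^ 3) =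
        (t ^ 3 * (1 + θ ^ 2 / t ^ 3)) * (6 / a ^ 3) := by ring
      _ ≤ _ := by gcongr

/-! ### Second-order expansion and the Gaussian limit -/

/-- A geometric variable of mean `u` has characteristic function `(1 - u (e ^ (i y) - 1))⁻¹` and
variance `u + u ^ 2`. The Taylor expansions of `log` to second order and of `exp` leave a cubic
remainder. -/
theorem norm_log_inv_sub_le {u y : ℝ} (hu : 0 ≤ u) (hy : |y| ≤ 1) (huy : u * |y| ≤ 1 / 4) :
    ‖Complex.log (1 - u * (Complex.exp (y * Complex.I) - 1))⁻¹ -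
      (u * y * Complex.I - (u + u ^ 2) * y ^ 2 / 2)‖ ≤ (u + u ^ 2 + u ^ 3) * |y| ^ 3 := by
  set e : ℂ := Complex.exp (y * Complex.I) - 1 with he
  have hn : ‖(y : ℂ) * Complex.I‖ = |y| := by simp
  have e1 : ‖e‖ ≤ |y| := by
    have := Real.norm_exp_I_mul_ofReal_sub_one_le (x := y)
    rwa [mul_comm, Real.norm_eq_abs] at this
  have e2 : ‖e - y * Complex.I‖ ≤ |y| ^ 2 := by
    have := Complex.norm_exp_sub_one_sub_id_le (x := y * Complex.I) (by rwa [hn])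
    rwa [hn] at this
  have e3 : ‖e - y * Complex.I + y ^ 2 / 2‖ ≤ |y| ^ 3 := by
    have := Complex.exp_bound (x := y * Complex.I) (by rwa [hn]) (n := 3) (by norm_num)
    rw [hn] at this
    have h2 : Complex.exp (y * Complex.I) - ∑ m ∈ Finset.range 3, (y * Complex.I) ^ m / m.factorial
        = e - y * Complex.I + y ^ 2 / 2 := by
      simp [Finset.sum_range_succ, he, mul_pow]
      ring
    rw [h2] at this
    refine this.trans ?_
    norm_num [Nat.factorial]
    nlinarith [pow_nonneg (abs_nonneg y) 3]
  have e4 : ‖e ^ 2 + y ^ 2‖ ≤ 2 * |y| ^ 3 := by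
    have : e ^ 2 + y ^ 2 = (e - y * Complex.I) * (e + y * Complex.I) := by
      ring_nf
      simp
    rw [this, norm_mul]
    calc ‖e - y * Complex.I‖ * ‖e + y * Complex.I‖ ≤ |y| ^ 2 * (|y| + |y|) := by
          gcongr
          exact (norm_add_le _ _).trans (add_le_add e1 hn.le)
      _ = _ := by ring
  set w : ℂ := u * e with hw
  have w1 : ‖w‖ ≤ u * |y| := by
    rw [hw, norm_mul, Complex.norm_real, Real.norm_of_nonneg hu]
    gcongr
  have w2 : ‖w‖ < 1 := by linarith
  have hlog := Complex.norm_log_one_sub_inv_add_logTaylor_neg_le 2 w2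
  have ht : Complex.logTaylor (2 + 1) (-w) = -w - w ^ 2 / 2 := by
    simp [Complex.logTaylor_succ, Complex.logTaylor_zero]
    ring
  rw [ht] at hlog
  have hlog' : ‖Complex.log (1 - w)⁻¹ + (-w - w ^ 2 / 2)‖ ≤ u ^ 3 * |y| ^ 3 := by
    refine hlog.trans ?_
    have h1 : (1 - ‖w‖)⁻¹ ≤ 3 := by
      rw [inv_le_comm₀ (by linarith) (by norm_num)]
      linarith
    have h2 : ‖w‖ ^ 3 ≤ u ^ 3 * |y| ^ 3 := by
      rw [← mul_pow]; gcongr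
    have h3 : 0 ≤ ‖w‖ ^ 3 := by positivity
    have h4 : ‖w‖ ^ 3 * (1 - ‖w‖)⁻¹ ≤ ‖w‖ ^ 3 * 3 := by gcongr
    norm_num
    linarith
  have hdec : Complex.log (1 - w)⁻¹ - (u * y * Complex.I - (u + u ^ 2) * y ^ 2 / 2) =
      (Complex.log (1 - w)⁻¹ + (-w - w ^ 2 / 2)) + u * (e - y * Complex.I + y ^ 2 / 2) +
        u ^ 2 / 2 * (e ^ 2 + y ^ 2) := by
    rw [hw]; ring
  rw [hdec]
  have n1 : ‖(u : ℂ) * (e - y * Complex.I + y ^ 2 / 2)‖ ≤ u * |y| ^ 3 := by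
    rw [norm_mul, Complex.norm_real, Real.norm_of_nonneg hu]
    gcongr
  have n2 : ‖(u : ℂ) ^ 2 / 2 * (e ^ 2 + y ^ 2)‖ ≤ u ^ 2 * |y| ^ 3 := by
    rw [norm_mul, norm_div, norm_pow, Complex.norm_real, Real.norm_of_nonneg hu]
    calc u ^ 2 / ‖(2 : ℂ)‖ * ‖e ^ 2 + (y : ℂ) ^ 2‖ ≤ u ^ 2 / 2 * (2 * |y| ^ 3) := by
          rw [Complex.norm_two]; gcongr
      _ = _ := by ring
  calc _ ≤ u ^ 3 * |y| ^ 3 + u * |y| ^ 3 + u ^ 2 * |y| ^ 3 :=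
        norm_add₃_le.trans (add_le_add_three hlog' n1 n2)
    _ = _ := by ring

/-- The mean multiplicity of the part `j`. -/
noncomputable def occ (t : ℝ) (j : ℕ) : ℝ := Real.exp (-t) ^ j / (1 - Real.exp (-t) ^ j)

theorem one_sub_exp_pow_pos {t : ℝ} (ht : 0 < t) {j : ℕ} (hj : 1 ≤ j) :
    0 < 1 - Real.exp (-t) ^ j :=
  sub_pos.2 (pow_lt_one₀ (Real.exp_pos _).le (Real.exp_lt_one_iff.2 (by linarith)) (by omega))

theorem occ_nonneg {t : ℝ} (ht : 0 < t) {j : ℕ} (hj : 1 ≤ j) : 0 ≤ occ t j :=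
  div_nonneg (pow_nonneg (Real.exp_pos _).le _) (one_sub_exp_pow_pos ht hj).le

theorem mul_occ_le {t : ℝ} (ht : 0 < t) {j : ℕ} (hj : 1 ≤ j) : j * t * occ t j ≤ 1 := by
  have h1 := one_sub_exp_pow_pos ht hj
  rw [occ, mul_div_assoc', div_le_one h1, ← Real.exp_nat_mul]
  have h2 := Real.add_one_le_exp (j * t)
  have h3 : Real.exp (j * -t) * Real.exp (j * t) = 1 := by
    rw [← Real.exp_add]; simp
  have h4 := Real.exp_pos (j * -t)
  nlinarith

/-- Mean total size of two independent random partitions with parts at most `m`. -/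
noncomputable def meanSize (t : ℝ) (m : ℕ) : ℝ := ∑ j ∈ Finset.Icc 1 m, 2 * (j * occ t j)

/-- Variance of the total size of two independent random partitions with parts at most `m`. -/
noncomputable def varSize (t : ℝ) (m : ℕ) : ℝ :=
  ∑ j ∈ Finset.Icc 1 m, 2 * (j ^ 2 * (occ t j + occ t j ^ 2))

/-- Principal logarithms are taken factor by factor, so no branch has to be followed along the
product. -/
theorem charFn_eq_exp {t : ℝ} (ht : 0 < t) (m : ℕ) (θ : ℝ) :
    charFn (Real.exp (-t)) m θ = Complex.exp (∑ j ∈ Finset.Icc 1 m,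
      2 * Complex.log (1 - (occ t j : ℝ) * (Complex.exp ((j * θ : ℝ) * Complex.I) - 1))⁻¹) := by
  rw [charFn, Complex.exp_sum]
  refine Finset.prod_congr rfl fun j hj => ?_
  have h1 := one_sub_exp_pow_pos ht (Finset.mem_Icc.1 hj).1
  have h2 : ((1 : ℂ) - (Real.exp (-t) : ℂ) ^ j) ≠ 0 := by exact_mod_cast h1.ne'
  set r : ℂ := (Real.exp (-t) : ℂ) ^ j
  set E := Complex.exp ((j * θ : ℝ) * Complex.I) with hE
  have hEE : Complex.exp (j * θ * Complex.I) = E := by rw [hE]; push_cast; rfl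
  have h3 : 1 - r * E ≠ 0 := by
    intro h
    have h4 : ‖r * E‖ = 1 := by rw [← sub_eq_zero.1 h, norm_one]
    rw [norm_mul, hE, Complex.norm_exp_ofReal_mul_I, mul_one, norm_pow, Complex.norm_real,
      Real.norm_of_nonneg (Real.exp_pos _).le] at h4
    linarith
  have h5 : 1 - ((occ t j : ℝ) : ℂ) * (E - 1) = (1 - r * E) / (1 - r) := by
    have h6 : ((occ t j : ℝ) : ℂ) = r / (1 - r) := by
      rw [occ, Complex.ofReal_div, Complex.ofReal_sub, Complex.ofReal_pow, Complex.ofReal_one]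
    rw [h6]
    field_simp
    ring
  rw [hEE, h5, two_mul, Complex.exp_add, Complex.exp_log, inv_div, sq]
  rw [inv_div]
  exact div_ne_zero h2 h3

/-- Since `j * occ t j ≤ 1 / t ≤ m` and `j ≤ m`, each cubic remainder is at most `3 m ^ 3 |θ| ^ 3`.
It is doubled for the two partitions and summed over `m` values of `j`. -/
theorem norm_log_charFn_sub_le {t : ℝ} (ht : 0 < t) {m : ℕ} (hm : 1 ≤ m * t) {θ : ℝ}
    (hθ : m * |θ| ≤ 1 / 4) :
    ‖(∑ j ∈ Finset.Icc 1 m,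
      2 * Complex.log (1 - (occ t j : ℝ) * (Complex.exp ((j * θ : ℝ) * Complex.I) - 1))⁻¹) -
      ((meanSize t m * θ : ℝ) * Complex.I - (varSize t m * θ ^ 2 / 2 : ℝ))‖ ≤
      6 * m ^ 4 * |θ| ^ 3 := by
  have hsum : ((meanSize t m * θ : ℝ) * Complex.I - (varSize t m * θ ^ 2 / 2 : ℝ) : ℂ) =
      ∑ j ∈ Finset.Icc 1 m, 2 * ((occ t j : ℝ) * (j * θ : ℝ) * Complex.I -
        (occ t j + occ t j ^ 2 : ℂ) * (j * θ : ℝ) ^ 2 / 2) := by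
    rw [meanSize, varSize, Finset.sum_mul, Finset.sum_mul, Finset.sum_div]
    push_cast
    rw [Finset.sum_mul, ← Finset.sum_sub_distrib]
    refine Finset.sum_congr rfl fun j _ => ?_
    ring
  rw [hsum, ← Finset.sum_sub_distrib]
  have hterm : ∀ j ∈ Finset.Icc 1 m, ‖2 * Complex.log (1 - (occ t j : ℝ) *
      (Complex.exp ((j * θ : ℝ) * Complex.I) - 1))⁻¹ - 2 * ((occ t j : ℝ) * (j * θ : ℝ) * Complex.I -
        (occ t j + occ t j ^ 2 : ℂ) * (j * θ : ℝ) ^ 2 / 2)‖ ≤ 6 * m ^ 3 * |θ| ^ 3 := by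
    intro j hj
    rw [Finset.mem_Icc] at hj
    have hjm : (j : ℝ) ≤ m := by exact_mod_cast hj.2
    have hj0 : (0 : ℝ) ≤ j := by positivity
    have hm0 : (0 : ℝ) ≤ m := by positivity
    have hu := occ_nonneg ht hj.1
    have hju : j * occ t j ≤ m := by
      have := mul_occ_le ht hj.1
      have h0 : 0 ≤ j * occ t j := by positivity
      nlinarith
    set u := occ t j
    have hy : |j * θ| ≤ 1 / 4 := by
      rw [abs_mul, Nat.abs_cast]
      exact (mul_le_mul_of_nonneg_right hjm (abs_nonneg _)).trans hθ
    have huy : u * |j * θ| ≤ 1 / 4 := by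
      rw [abs_mul, Nat.abs_cast]
      calc u * (j * |θ|) = (j * u) * |θ| := by ring
        _ ≤ m * |θ| := by gcongr
        _ ≤ _ := hθ
    have key := norm_log_inv_sub_le hu (by linarith) huy
    rw [← mul_sub, norm_mul, Complex.norm_two]
    have h1 : (u + u ^ 2 + u ^ 3) * |j * θ| ^ 3 ≤ 3 * m ^ 3 * |θ| ^ 3 := by
      rw [abs_mul, Nat.abs_cast, mul_pow, ← mul_assoc]
      refine mul_le_mul_of_nonneg_right ?_ (by positivity)
      calc (u + u ^ 2 + u ^ 3) * (j : ℝ) ^ 3 =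
          (j * u) * j * j + (j * u) * (j * u) * j + (j * u) * (j * u) * (j * u) := by ring
        _ ≤ m * m * m + m * m * m + m * m * m := by gcongr
        _ = _ := by ring
    linarith
  refine (norm_sum_le_of_le _ hterm).trans (le_of_eq ?_)
  rw [Finset.sum_const, Nat.card_Icc, nsmul_eq_mul]
  simp
  ring

/-- Central limit theorem for the total size, in terms of characteristic functions. -/
theorem tendsto_charFn {ι : Type*} {l : Filter ι} {t h : ι → ℝ} {m k : ι → ℕ} {s : ℝ}
    (ht : ∀ᶠ i in l, 0 < t i) (hh : ∀ᶠ i in l, 0 < h i) (hmt : ∀ᶠ i in l, 1 ≤ m i * t i)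
    (hmh : Tendsto (fun i => (m i : ℝ) ^ 4 * h i ^ 3) l (𝓝 0))
    (hmean : Tendsto (fun i => h i * (meanSize (t i) (m i) - k i)) l (𝓝 0))
    (hvar : Tendsto (fun i => h i ^ 2 * varSize (t i) (m i)) l (𝓝 s)) (x : ℝ) :
    Tendsto (fun i => charFn (Real.exp (-t i)) (m i) (h i * x) *
      Complex.exp (-(k i * (h i * x : ℝ) * Complex.I))) l
      (𝓝 (Complex.exp ((-(s * x ^ 2 / 2) : ℝ)))) := by
  set A : ι → ℂ := fun i => ∑ j ∈ Finset.Icc 1 (m i), 2 * Complex.log (1 - (occ (t i) j : ℝ) *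
    (Complex.exp ((j * (h i * x) : ℝ) * Complex.I) - 1))⁻¹ with hA
  set G : ι → ℂ := fun i => ((meanSize (t i) (m i) * (h i * x) : ℝ) * Complex.I -
    (varSize (t i) (m i) * (h i * x) ^ 2 / 2 : ℝ)) with hG
  have hsmall : Tendsto (fun i => (m i : ℝ) ^ 4 * h i ^ 3 * |x| ^ 3) l (𝓝 0) := by
    simpa using hmh.mul_const (|x| ^ 3)
  -- Because `m ≥ 1`, smallness of `m ^ 4 h ^ 3 |x| ^ 3` also bounds the cube of `m h |x|`; the
  -- threshold is `1 / 64 = (1 / 4) ^ 3`.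
  have hev : ∀ᶠ i in l, m i * |h i * x| ≤ 1 / 4 := by
    filter_upwards [hsmall.eventually_lt_const (show (0 : ℝ) < 1 / 64 by norm_num), ht, hh, hmt]
      with i h1 h2 h3 h4
    have hm1 : (1 : ℝ) ≤ m i := by
      have : m i ≠ 0 := by
        intro h0
        rw [h0] at h4
        norm_num at h4
      exact_mod_cast Nat.one_le_iff_ne_zero.2 this
    rw [abs_mul, abs_of_pos h3]
    have h5 : (m i * (h i * |x|)) ^ 3 ≤ (1 / 4) ^ 3 := by
      calc (m i * (h i * |x|)) ^ 3 = (m i) ^ 3 * h i ^ 3 * |x| ^ 3 := by ring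
        _ ≤ (m i) ^ 4 * h i ^ 3 * |x| ^ 3 := by
          gcongr
          norm_num
        _ ≤ _ := by linarith
    exact le_of_pow_le_pow_left₀ (by norm_num) (by norm_num) h5
  have hAG : Tendsto (fun i => A i - G i) l (𝓝 0) := by
    refine squeeze_zero_norm' ?_ (by simpa using hsmall.const_mul 6)
    filter_upwards [ht, hh, hmt, hev] with i h1 h2 h3 h4
    refine (norm_log_charFn_sub_le h1 h3 h4).trans (le_of_eq ?_)
    rw [abs_mul, abs_of_pos h2]
    ring
  have hGk : Tendsto (fun i => G i - k i * (h i * x : ℝ) * Complex.I) l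
      (𝓝 ((-(s * x ^ 2 / 2) : ℝ))) := by
    have h1 : ∀ i, G i - k i * (h i * x : ℝ) * Complex.I =
        ((h i * (meanSize (t i) (m i) - k i) * x : ℝ) : ℂ) * Complex.I -
          ((h i ^ 2 * varSize (t i) (m i) * x ^ 2 / 2 : ℝ) : ℂ) := by
      intro i
      simp only [hG]
      push_cast
      ring
    simp_rw [h1]
    have h2 := (Complex.continuous_ofReal.tendsto _).comp (hmean.mul_const x)
    have h3 := (Complex.continuous_ofReal.tendsto _).comp ((hvar.mul_const (x ^ 2)).div_const 2)
    have h4 := (h2.mul_const Complex.I).sub h3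
    simpa using h4
  have hfin := hAG.add hGk
  rw [zero_add] at hfin
  refine ((Complex.continuous_exp.tendsto _).comp hfin).congr' ?_
  filter_upwards [ht] with i h1
  rw [Function.comp_apply, charFn_eq_exp h1, ← Complex.exp_add]
  congr 1
  simp only [hA]
  ring

/-! ### Riemann sums for the mean and the variance -/

/-- Riemann sums of antitone functions with values in `[0, 1]`. -/
theorem abs_riemannSum_sub_le {f : ℝ → ℝ} (hf : AntitoneOn f (Set.Ioi 0))
    (hf0 : ∀ x, 0 < x → 0 ≤ f x) (hf1 : ∀ x, 0 < x → f x ≤ 1)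
    (hfi : IntegrableOn f (Set.Ioi 0)) {t : ℝ} (ht : 0 < t) {m : ℕ} (hm : 1 ≤ m) :
    |t * ∑ j ∈ Finset.Icc 1 m, f (j * t) - ∫ x in Set.Ioi 0, f x| ≤
      t + ∫ x in Set.Ioi (m * t), f x := by
  obtain ⟨a, rfl⟩ : ∃ a, m = a + 1 := ⟨m - 1, by omega⟩
  set g : ℝ → ℝ := fun x => f (x * t) with hg
  have hanti : ∀ b : ℝ, AntitoneOn g (Set.Icc 1 b) := fun b x hx y hy hxy =>
    hf (mul_pos (by linarith [hx.1]) ht) (mul_pos (by linarith [hy.1]) ht)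
      (mul_le_mul_of_nonneg_right hxy ht.le)
  have h1 : ∑ j ∈ Finset.Icc 1 (a + 1), f (j * t) = ∑ i ∈ Finset.range (a + 1), g (1 + i) := by
    have h := Finset.sum_Ico_add' (fun j : ℕ => f (j * t)) 0 (a + 1) 1
    have h2 : Finset.Ico (0 + 1) (a + 1 + 1) = Finset.Icc 1 (a + 1) := by ext; simp
    rw [h2] at h
    rw [← h, Finset.range_eq_Ico]
    refine Finset.sum_congr rfl fun i _ => ?_
    simp only [hg]
    push_cast
    ring_nf
  have hint : ∀ b : ℝ, t * ∫ x in (1 : ℝ)..b, g x = ∫ x in t..(b * t), f x := by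
    intro b
    simp only [hg]
    rw [← smul_eq_mul, intervalIntegral.smul_integral_comp_mul_right, one_mul]
  have hlow := (hanti (1 + (a + 1 : ℕ))).integral_le_sum
  have hup := (hanti (1 + a)).sum_le_integral
  rw [← h1] at hlow
  have hsum : ∑ j ∈ Finset.Icc 1 (a + 1), f (j * t) =
      f t + ∑ i ∈ Finset.range a, g (1 + ((i + 1 : ℕ) : ℝ)) := by
    rw [h1, Finset.sum_range_succ']
    simp [hg, add_comm]
  have hmt : (0 : ℝ) < (a + 1 : ℕ) * t := by positivity
  have hsplit : ∀ b : ℝ, 0 ≤ b → ∫ x in Set.Ioi 0, f x = (∫ x in (0 : ℝ)..b, f x) +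
      ∫ x in Set.Ioi b, f x := fun b hb =>
    (intervalIntegral.integral_interval_add_Ioi hfi (hfi.mono_set (Set.Ioi_subset_Ioi hb))).symm
  have hii : ∀ x y : ℝ, 0 ≤ x → 0 ≤ y → IntervalIntegrable f volume x y := by
    intro x y hx hy
    rw [intervalIntegrable_iff]
    refine hfi.mono_set fun z hz => ?_
    exact lt_of_le_of_lt (le_min hx hy) hz.1
  -- The sum starts at `j = 1`, so the comparison integrals start at `t`; the piece over `(0, t)`
  -- costs at most `t`.
  have hsmall : ∫ x in (0 : ℝ)..t, f x ≤ t := by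
    have := intervalIntegral.integral_mono_on_of_le_Ioo ht.le (hii 0 t le_rfl ht.le)
      (intervalIntegrable_const (c := (1 : ℝ))) fun x hx => hf1 x hx.1
    simpa using this
  have hnn : ∀ x y : ℝ, 0 ≤ x → x ≤ y → 0 ≤ ∫ z in x..y, f z := by
    intro x y hx hxy
    rw [intervalIntegral.integral_of_le hxy]
    exact setIntegral_nonneg measurableSet_Ioc fun z hz => hf0 z (lt_of_le_of_lt hx hz.1)
  have hsmall0 : 0 ≤ ∫ x in (0 : ℝ)..t, f x := hnn 0 t le_rfl ht.le
  have htail : 0 ≤ ∫ x in Set.Ioi ((a + 1 : ℕ) * t), f x :=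
    setIntegral_nonneg measurableSet_Ioi fun x hx => hf0 x (hmt.trans hx)
  have hlow' : (∫ x in t..((a + 1 : ℕ) * t), f x) ≤
      t * ∑ j ∈ Finset.Icc 1 (a + 1), f (j * t) := by
    have h2 := mul_le_mul_of_nonneg_left hlow ht.le
    rw [hint] at h2
    refine le_trans ?_ h2
    rw [← intervalIntegral.integral_add_adjacent_intervals
      (hii t ((a + 1 : ℕ) * t) ht.le hmt.le)
      (hii ((a + 1 : ℕ) * t) ((1 + (a + 1 : ℕ)) * t) hmt.le (by positivity))]
    refine le_add_of_nonneg_right (hnn _ _ hmt.le ?_)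
    nlinarith
  have hup' : t * ∑ j ∈ Finset.Icc 1 (a + 1), f (j * t) ≤
      t + ∫ x in t..((a + 1 : ℕ) * t), f x := by
    have h2 := mul_le_mul_of_nonneg_left hup ht.le
    rw [hint] at h2
    rw [hsum, mul_add]
    refine add_le_add (mul_le_of_le_one_right ht.le (hf1 t ht)) (h2.trans (le_of_eq ?_))
    push_cast
    ring_nf
  have h3 := hsplit _ hmt.le
  rw [← intervalIntegral.integral_add_adjacent_intervals (hii 0 t le_rfl ht.le)
    (hii t ((a + 1 : ℕ) * t) ht.le hmt.le)] at h3
  rw [h3, abs_le]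
  constructor <;> linarith

theorem one_add_le_mul_exp {x c : ℝ} (hc : 1 ≤ c) (hx : 0 ≤ x) : 1 + x ≤ c * Real.exp (x / c) := by
  have h := Real.add_one_le_exp (x / c)
  have h2 : c * (x / c + 1) ≤ c * Real.exp (x / c) := by gcongr
  have h3 : c * (x / c + 1) = x + c := by field_simp
  linarith

/-- The density `x / (e ^ x - 1)`. -/
noncomputable def bose (x : ℝ) : ℝ := x / (Real.exp x - 1)

theorem exp_sub_one_pos {x : ℝ} (hx : 0 < x) : 0 < Real.exp x - 1 := by
  linarith [Real.add_one_lt_exp hx.ne']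

theorem bose_nonneg {x : ℝ} (hx : 0 < x) : 0 ≤ bose x :=
  div_nonneg hx.le (exp_sub_one_pos hx).le

theorem bose_le_one {x : ℝ} (hx : 0 < x) : bose x ≤ 1 := by
  rw [bose, div_le_one (exp_sub_one_pos hx)]
  linarith [Real.add_one_le_exp x]

theorem bose_antitoneOn : AntitoneOn bose (Set.Ioi 0) := by
  intro x hx y hy hxy
  rw [Set.mem_Ioi] at hx hy
  have h := convexOn_exp.secant_mono (Set.mem_univ 0) (Set.mem_univ x) (Set.mem_univ y)
    hx.ne' hy.ne' hxy
  simp only [Real.exp_zero, sub_zero] at h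
  have h2 := inv_anti₀ (div_pos (exp_sub_one_pos hx) hx) h
  simpa [bose, inv_div] using h2

theorem le_one_add_mul_one_sub_exp_neg (x : ℝ) :
    x ≤ (1 + x) * (1 - Real.exp (-x)) := by
  have h6 := Real.add_one_le_exp x
  have h7 : Real.exp (-x) * Real.exp x = 1 := by rw [← Real.exp_add]; simp
  have h8 := Real.exp_pos (-x)
  nlinarith

/-- A linear factor is absorbed into an exponential of arbitrarily small rate `1 / c`, at the price
of the constant `c`. -/
theorem le_mul_exp_mul_one_sub_exp_neg {x c : ℝ} (hc : 1 ≤ c) (hx : 0 ≤ x) :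
    x ≤ c * Real.exp (x / c) * (1 - Real.exp (-x)) := by
  have h : 0 ≤ 1 - Real.exp (-x) := sub_nonneg.2 (Real.exp_le_one_iff.2 (by linarith))
  refine (le_one_add_mul_one_sub_exp_neg x).trans ?_
  gcongr
  exact one_add_le_mul_exp hc hx

/-- The rate must be close to `1`: on the window `m t ≥ 3/4 * center n`, and `7/8 * 3/4 = 21/32` has
to exceed `1/2` for the error in the mean to be `o(√t)`. -/
theorem bose_le_exp {x : ℝ} (hx : 0 < x) : bose x ≤ 8 * Real.exp (-(7 / 8) * x) := by
  rw [bose, div_le_iff₀ (exp_sub_one_pos hx)]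
  refine (le_mul_exp_mul_one_sub_exp_neg (c := 8) (by norm_num) hx.le).trans (le_of_eq ?_)
  have h1 : Real.exp (x / 8) = Real.exp (-(7 / 8) * x) * Real.exp x := by
    rw [← Real.exp_add]; ring_nf
  have h2 : Real.exp x * Real.exp (-x) = 1 := by rw [← Real.exp_add]; simp
  rw [h1]
  linear_combination (-8 * Real.exp (-(7 / 8) * x)) * h2

theorem bose_integrableOn : IntegrableOn bose (Set.Ioi 0) := by
  have h1 : IntegrableOn (fun x : ℝ => 8 * Real.exp (-(7 / 8) * x)) (Set.Ioi 0) :=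
    (exp_neg_integrableOn_Ioi 0 (by norm_num)).const_mul 8
  refine Integrable.mono' h1 ?_ ?_
  · unfold bose
    exact (by fun_prop : Measurable _).aestronglyMeasurable
  · refine (ae_restrict_mem measurableSet_Ioi).mono fun x hx => ?_
    rw [Real.norm_of_nonneg (bose_nonneg hx)]
    exact bose_le_exp hx

theorem bose_tail_le {a : ℝ} (ha : 0 ≤ a) :
    ∫ x in Set.Ioi a, bose x ≤ 64 / 7 * Real.exp (-(7 / 8) * a) := by
  have h1 : IntegrableOn (fun x : ℝ => 8 * Real.exp (-(7 / 8) * x)) (Set.Ioi a) :=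
    (exp_neg_integrableOn_Ioi a (by norm_num)).const_mul 8
  refine (setIntegral_mono_on (bose_integrableOn.mono_set (Set.Ioi_subset_Ioi ha)) h1
    measurableSet_Ioi fun x hx => bose_le_exp (lt_of_le_of_lt ha hx)).trans (le_of_eq ?_)
  rw [integral_const_mul, integral_exp_mul_Ioi (by norm_num)]
  ring

/-- Expand `1 / (e ^ x - 1)` as a geometric series in `e ^ (-x)` and integrate termwise, which gives
`ζ(2)`. -/
theorem integral_bose : ∫ x in Set.Ioi 0, bose x = Real.pi ^ 2 / 6 := by
  have hk : ∀ k : ℕ, ∫ x in Set.Ioi (0 : ℝ), x * Real.exp (-((k + 1) * x)) = 1 / (k + 1 : ℝ) ^ 2 := by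
    intro k
    have := Real.integral_rpow_mul_exp_neg_mul_Ioi (a := 2) (r := k + 1) (by norm_num)
      (by positivity)
    rw [show (2 : ℝ) - 1 = 1 by norm_num] at this
    simp only [Real.rpow_one, Real.Gamma_two, mul_one] at this
    rw [this]
    simp
  have hint : ∀ k : ℕ, IntegrableOn (fun x : ℝ => x * Real.exp (-((k + 1) * x))) (Set.Ioi 0) := by
    intro k
    have := integrableOn_rpow_mul_exp_neg_mul_rpow (p := 1) (s := 1) (b := k + 1) (by norm_num)
      (by norm_num) (by positivity)
    simpa only [Real.rpow_one, neg_mul] using this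
  have hsum : HasSum (fun k : ℕ => 1 / (k + 1 : ℝ) ^ 2) (Real.pi ^ 2 / 6) := by
    have := (hasSum_nat_add_iff' 1).2 hasSum_zeta_two
    simpa using this
  have hnorm : ∀ k : ℕ, ∫ x in Set.Ioi (0 : ℝ), ‖x * Real.exp (-((k + 1) * x))‖ =
      1 / (k + 1 : ℝ) ^ 2 := by
    intro k
    rw [← hk k]
    refine setIntegral_congr_fun measurableSet_Ioi fun x hx => ?_
    rw [Set.mem_Ioi] at hx
    exact Real.norm_of_nonneg (by positivity)
  have h1 := hasSum_integral_of_summable_integral_norm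
    (F := fun (k : ℕ) (x : ℝ) => x * Real.exp (-((k + 1) * x)))
    (μ := volume.restrict (Set.Ioi 0)) hint (by simp_rw [hnorm]; exact hsum.summable)
  simp_rw [hk] at h1
  rw [← h1.unique hsum]
  refine setIntegral_congr_fun measurableSet_Ioi fun x hx => ?_
  rw [Set.mem_Ioi] at hx
  have h2 : ∀ k : ℕ, x * Real.exp (-((k + 1) * x)) =
      x * Real.exp (-x) * (Real.exp (-x)) ^ k := by
    intro k
    rw [← Real.exp_nat_mul, mul_assoc, ← Real.exp_add]
    ring_nf
  simp_rw [h2]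
  rw [tsum_mul_left, tsum_geometric_of_lt_one (Real.exp_pos _).le
    (Real.exp_lt_one_iff.2 (by linarith)), bose]
  have h3 := exp_sub_one_pos hx
  have h4 : 1 - Real.exp (-x) = Real.exp (-x) * (Real.exp x - 1) := by
    rw [mul_sub, ← Real.exp_add]; simp
  rw [h4]
  have := (Real.exp_pos (-x)).ne'
  field_simp

/-- The density `(x / 2 / sinh (x / 2)) ^ 2`. -/
noncomputable def boseVar (x : ℝ) : ℝ := (x / 2 / Real.sinh (x / 2)) ^ 2

theorem convexOn_sinh : ConvexOn ℝ (Set.Ici 0) Real.sinh := by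
  refine MonotoneOn.convexOn_of_deriv (convex_Ici 0) Real.continuous_sinh.continuousOn
    Real.differentiable_sinh.differentiableOn ?_
  rw [interior_Ici, Real.deriv_sinh]
  exact Real.cosh_strictMonoOn.monotoneOn.mono Set.Ioi_subset_Ici_self

/-- Writing the density through `sinh` makes monotonicity a statement about secant slopes: `sinh` is
convex on the nonnegative axis, so `sinh y / y` increases. -/
theorem boseVar_antitoneOn : AntitoneOn boseVar (Set.Ioi 0) := by
  intro x hx y hy hxy
  rw [Set.mem_Ioi] at hx hy
  have hx2 : 0 < x / 2 := by linarith
  have hy2 : 0 < y / 2 := by linarith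
  have h := convexOn_sinh.secant_mono (a := 0) (by simp) (Set.mem_Ici.2 hx2.le)
    (Set.mem_Ici.2 hy2.le) hx2.ne' hy2.ne' (by linarith : x / 2 ≤ y / 2)
  simp only [Real.sinh_zero, sub_zero] at h
  have h2 := inv_anti₀ (div_pos (Real.sinh_pos_iff.2 hx2) hx2) h
  rw [inv_div, inv_div] at h2
  have h3 : 0 ≤ y / 2 / Real.sinh (y / 2) := div_nonneg hy2.le (Real.sinh_pos_iff.2 hy2).le
  simp only [boseVar]
  gcongr

theorem boseVar_nonneg (x : ℝ) : 0 ≤ boseVar x := sq_nonneg _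

theorem boseVar_le_one {x : ℝ} (hx : 0 < x) : boseVar x ≤ 1 := by
  have hx2 : 0 < x / 2 := by linarith
  have h1 := Real.sinh_pos_iff.2 hx2
  refine pow_le_one₀ (by positivity) ?_
  rw [div_le_one h1]
  exact Real.self_le_sinh_iff.2 hx2.le

theorem boseVar_eq {x : ℝ} (hx : 0 < x) :
    boseVar x = x ^ 2 * Real.exp (-x) / (1 - Real.exp (-x)) ^ 2 := by
  have hx2 : 0 < x / 2 := by linarith
  have h1 : Real.sinh (x / 2) = Real.exp (x / 2) * (1 - Real.exp (-x)) / 2 := by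
    rw [Real.sinh_eq, mul_sub, ← Real.exp_add]
    ring_nf
  have h2 : Real.exp (-x) * Real.exp (x / 2) ^ 2 = 1 := by
    rw [← Real.exp_nat_mul, ← Real.exp_add]
    simp
    ring
  have h3 : Real.exp (-x) < 1 := Real.exp_lt_one_iff.2 (by linarith)
  have h4 : 1 - Real.exp (-x) ≠ 0 := by linarith
  rw [boseVar, h1, div_pow, div_pow, div_pow, mul_pow, div_div_div_cancel_right₀ (by norm_num),
    div_eq_div_iff (by positivity) (by positivity)]
  linear_combination (x ^ 2 * (1 - Real.exp (-x)) ^ 2) * (-h2)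

theorem boseVar_le_exp {x : ℝ} (hx : 0 < x) : boseVar x ≤ 16 * Real.exp (-(1 / 2) * x) := by
  have h3 : Real.exp (-x) < 1 := Real.exp_lt_one_iff.2 (by linarith)
  have h4 : 0 < 1 - Real.exp (-x) := by linarith
  rw [boseVar_eq hx, div_le_iff₀ (by positivity)]
  have h6 := le_mul_exp_mul_one_sub_exp_neg (c := 4) (by norm_num) hx.le
  calc x ^ 2 * Real.exp (-x) ≤ (4 * Real.exp (x / 4) * (1 - Real.exp (-x))) ^ 2 * Real.exp (-x) := by
        gcongr
    _ = 16 * (Real.exp (x / 4) ^ 2 * Real.exp (-x)) * (1 - Real.exp (-x)) ^ 2 := by ring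
    _ = _ := by
      rw [← Real.exp_nat_mul, ← Real.exp_add]
      congr 3
      push_cast
      ring

theorem boseVar_integrableOn : IntegrableOn boseVar (Set.Ioi 0) := by
  have h1 : IntegrableOn (fun x : ℝ => 16 * Real.exp (-(1 / 2) * x)) (Set.Ioi 0) :=
    (exp_neg_integrableOn_Ioi 0 (by norm_num)).const_mul 16
  refine Integrable.mono' h1 ?_ ?_
  · unfold boseVar
    exact (by fun_prop : Measurable _).aestronglyMeasurable
  · refine (ae_restrict_mem measurableSet_Ioi).mono fun x hx => ?_
    rw [Real.norm_of_nonneg (boseVar_nonneg x)]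
    exact boseVar_le_exp hx

theorem boseVar_tail_le {a : ℝ} (ha : 0 ≤ a) :
    ∫ x in Set.Ioi a, boseVar x ≤ 32 * Real.exp (-(1 / 2) * a) := by
  have h1 : IntegrableOn (fun x : ℝ => 16 * Real.exp (-(1 / 2) * x)) (Set.Ioi a) :=
    (exp_neg_integrableOn_Ioi a (by norm_num)).const_mul 16
  refine (setIntegral_mono_on (boseVar_integrableOn.mono_set (Set.Ioi_subset_Ioi ha)) h1
    measurableSet_Ioi fun x hx => boseVar_le_exp (lt_of_le_of_lt ha hx)).trans (le_of_eq ?_)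
  rw [integral_const_mul, integral_exp_mul_Ioi (by norm_num)]
  ring

theorem integral_boseVar_pos : 0 < ∫ x in Set.Ioi 0, boseVar x := by
  rw [setIntegral_pos_iff_support_of_nonneg_ae (ae_of_all _ boseVar_nonneg) boseVar_integrableOn]
  have : Set.Ioi (0 : ℝ) ⊆ Function.support boseVar ∩ Set.Ioi 0 := by
    intro x hx
    refine ⟨?_, hx⟩
    rw [Set.mem_Ioi] at hx
    have hx2 : 0 < x / 2 := by linarith
    have h1 := Real.sinh_pos_iff.2 hx2
    have : 0 < boseVar x := by unfold boseVar; positivity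
    exact this.ne'
  exact lt_of_lt_of_le (by simp) (measure_mono this)

theorem mul_occ_eq_bose {t : ℝ} (ht : 0 < t) {j : ℕ} (hj : 1 ≤ j) :
    j * t * occ t j = bose (j * t) := by
  have hjt : 0 < j * t := mul_pos (by exact_mod_cast hj) ht
  have h1 := exp_sub_one_pos hjt
  have h2 := one_sub_exp_pow_pos ht hj
  have h3 : Real.exp (-t) ^ j * Real.exp (j * t) = 1 := by
    rw [← Real.exp_nat_mul, ← Real.exp_add]; simp
  rw [occ, bose, mul_div_assoc', div_eq_div_iff h2.ne' h1.ne']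
  linear_combination (j * t) * h3

theorem sq_mul_occ_eq_boseVar {t : ℝ} (ht : 0 < t) {j : ℕ} (hj : 1 ≤ j) :
    (j * t) ^ 2 * (occ t j + occ t j ^ 2) = boseVar (j * t) := by
  have hjt : 0 < j * t := mul_pos (by exact_mod_cast hj) ht
  have h2 := one_sub_exp_pow_pos ht hj
  have h3 : Real.exp (-t) ^ j = Real.exp (-(j * t)) := by
    rw [← Real.exp_nat_mul]; ring_nf
  rw [boseVar_eq hjt, occ]
  rw [← h3]
  field_simp
  ring

theorem abs_meanSize_sub_le {t : ℝ} (ht : 0 < t) {m : ℕ} (hm : 1 ≤ m) :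
    |t ^ 2 * meanSize t m - Real.pi ^ 2 / 3| ≤ 2 * t + 128 / 7 * Real.exp (-(7 / 8) * (m * t)) := by
  have h1 : t ^ 2 * meanSize t m = 2 * (t * ∑ j ∈ Finset.Icc 1 m, bose (j * t)) := by
    rw [meanSize, Finset.mul_sum, Finset.mul_sum, Finset.mul_sum]
    refine Finset.sum_congr rfl fun j hj => ?_
    rw [← mul_occ_eq_bose ht (Finset.mem_Icc.1 hj).1]
    ring
  have h2 := abs_riemannSum_sub_le bose_antitoneOn (fun x hx => bose_nonneg hx)
    (fun x hx => bose_le_one hx) bose_integrableOn ht hm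
  have h3 := bose_tail_le (a := m * t) (by positivity)
  rw [integral_bose] at h2
  rw [h1, show 2 * (t * ∑ j ∈ Finset.Icc 1 m, bose (j * t)) - Real.pi ^ 2 / 3 =
    2 * (t * ∑ j ∈ Finset.Icc 1 m, bose (j * t) - Real.pi ^ 2 / 6) by ring, abs_mul, abs_two]
  linarith

theorem abs_varSize_sub_le {t : ℝ} (ht : 0 < t) {m : ℕ} (hm : 1 ≤ m) :
    |t ^ 3 * varSize t m - 2 * ∫ x in Set.Ioi 0, boseVar x| ≤
      2 * t + 64 * Real.exp (-(1 / 2) * (m * t)) := by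
  have h1 : t ^ 3 * varSize t m = 2 * (t * ∑ j ∈ Finset.Icc 1 m, boseVar (j * t)) := by
    rw [varSize, Finset.mul_sum, Finset.mul_sum, Finset.mul_sum]
    refine Finset.sum_congr rfl fun j hj => ?_
    rw [← sq_mul_occ_eq_boseVar ht (Finset.mem_Icc.1 hj).1]
    ring
  have h2 := abs_riemannSum_sub_le boseVar_antitoneOn (fun x _ => boseVar_nonneg x)
    (fun x hx => boseVar_le_one hx) boseVar_integrableOn ht hm
  have h3 := boseVar_tail_le (a := m * t) (by positivity)
  rw [h1, ← mul_sub, abs_mul, abs_two]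
  linarith

/-! ### Scaling parameters and the window of typical peaks -/

theorem B_pos : 0 < B := by unfold B; positivity

/-- The Boltzmann parameter: the weight of a part `j` is `exp (-j * temp n)`. -/
noncomputable def temp (n : ℕ) : ℝ := 1 / (B * √(n : ℝ))

/-- The centring of the peak, in units of `1 / temp n`. -/
noncomputable def center (n : ℕ) : ℝ := Real.log (2 * B * √(n : ℝ))

theorem temp_pos {n : ℕ} (hn : 1 ≤ n) : 0 < temp n := by
  have h0 : (0 : ℝ) < n := by exact_mod_cast hn
  have := B_pos
  unfold temp; positivity

/-- This fixes the constant `B`: the leading mean size `π ^ 2 / (3 t ^ 2)` of the two partitions is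
exactly `n`. -/
theorem mul_temp_sq {n : ℕ} (hn : 1 ≤ n) : n * temp n ^ 2 = Real.pi ^ 2 / 3 := by
  have h0 : (0 : ℝ) < n := by exact_mod_cast hn
  rw [temp, B, div_pow, mul_pow, div_pow, Real.sq_sqrt h0.le, Real.sq_sqrt (by norm_num)]
  field_simp

theorem exp_neg_center {n : ℕ} (hn : 1 ≤ n) : Real.exp (-center n) = temp n / 2 := by
  have h0 : (0 : ℝ) < n := by exact_mod_cast hn
  have := B_pos
  rw [center, Real.exp_neg, Real.exp_log (by positivity), temp]
  field_simp

theorem tendsto_temp : Tendsto temp atTop (𝓝 0) := by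
  have h : Tendsto (fun n : ℕ => B * √(n : ℝ)) atTop atTop :=
    (Real.tendsto_sqrt_atTop.comp tendsto_natCast_atTop_atTop).const_mul_atTop B_pos
  exact h.inv_tendsto_atTop.congr fun n => (one_div _).symm

theorem tendsto_center : Tendsto center atTop atTop := by
  have h : Tendsto (fun n : ℕ => 2 * B * √(n : ℝ)) atTop atTop :=
    (Real.tendsto_sqrt_atTop.comp tendsto_natCast_atTop_atTop).const_mul_atTop
      (mul_pos two_pos B_pos)
  exact Real.tendsto_log_atTop.comp h

/-- The pairs `(n, m)` for which `m` is a typical peak of a unimodal sequence of size `n`. -/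
def window : Set (ℕ × ℕ) :=
  {p | 3 / 4 * center p.1 ≤ p.2 * temp p.1 ∧ p.2 * temp p.1 ≤ 2 * center p.1}

/-- The filter of typical pairs `(n, m)` with `n` tending to infinity. -/
def windowFilter : Filter (ℕ × ℕ) := comap Prod.fst atTop ⊓ 𝓟 window

instance : windowFilter.IsCountablyGenerated := by unfold windowFilter; infer_instance

theorem tendsto_fst_windowFilter : Tendsto Prod.fst windowFilter atTop :=
  tendsto_comap.mono_left inf_le_left

theorem eventually_mem_window : ∀ᶠ p in windowFilter, p ∈ window :=
  mem_inf_of_right (mem_principal_self _)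

/-! ### The local limit theorem -/

/-- The probability that the total size is `n - m`, normalised by `temp n ^ (3 / 2)`. -/
noncomputable def localDensity (n m : ℕ) : ℝ :=
  pairProb (Real.exp (-temp n)) m (n - m) / (temp n * √(temp n))

/-- The rescaled integrand in the Fourier inversion formula. -/
noncomputable def fourierKernel (t : ℝ) (m k : ℕ) (x : ℝ) : ℂ :=
  (Set.Ioc (-(Real.pi / (t * √t))) (Real.pi / (t * √t))).indicator
    (fun x => charFn (Real.exp (-t)) m (t * √t * x) *
      Complex.exp (-(k * (t * √t * x : ℝ) * Complex.I))) x

theorem measurable_charFn (q : ℝ) (m : ℕ) : Measurable (charFn q m) := by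
  unfold charFn
  exact Finset.measurable_fun_prod _ fun j _ => by fun_prop

theorem measurable_fourierKernel (t : ℝ) (m k : ℕ) : Measurable (fourierKernel t m k) := by
  unfold fourierKernel
  refine Measurable.indicator ?_ measurableSet_Ioc
  exact ((measurable_charFn _ _).comp (by fun_prop)).mul (by fun_prop)

/-- Fourier inversion after `θ = t √t x`. Cutting off with an indicator puts the integrals for all
`t` on the whole line, as dominated convergence requires. -/
theorem integral_fourierKernel {t : ℝ} (ht : 0 < t) (m k : ℕ) :
    ∫ x, fourierKernel t m k x =
      ((2 * Real.pi * (pairProb (Real.exp (-t)) m k / (t * √t)) : ℝ) : ℂ) := by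
  have hh : 0 < t * √t := by positivity
  have hpi := Real.pi_pos
  unfold fourierKernel
  rw [integral_indicator measurableSet_Ioc,
    ← intervalIntegral.integral_of_le (by linarith [div_pos hpi hh])]
  have h1 := intervalIntegral.integral_comp_mul_left (a := -(Real.pi / (t * √t)))
    (b := Real.pi / (t * √t)) (fun θ : ℝ => charFn (Real.exp (-t)) m θ *
      Complex.exp (-(k * θ * Complex.I))) hh.ne'
  rw [h1, mul_neg, mul_div_cancel₀ _ hh.ne', integral_charFn (Real.exp_pos _)
    (Real.exp_lt_one_iff.2 (by linarith)), Complex.real_smul, ← Complex.ofReal_mul]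
  congr 1
  field_simp

theorem exists_norm_fourierKernel_le : ∃ C : ℝ, 0 < C ∧ ∀ t : ℝ, 0 < t → t ≤ 1 → ∀ m : ℕ,
    1 ≤ m * t → ∀ (k : ℕ) (x : ℝ), ‖fourierKernel t m k x‖ ≤ C * (1 + x ^ 2)⁻¹ := by
  obtain ⟨C, hC, h⟩ := exists_norm_charFn_le
  refine ⟨C, hC, fun t ht ht1 m hm k x => ?_⟩
  have hh : 0 < t * √t := by positivity
  unfold fourierKernel
  by_cases hx : x ∈ Set.Ioc (-(Real.pi / (t * √t))) (Real.pi / (t * √t))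
  · rw [Set.indicator_of_mem hx, norm_mul]
    have h1 : ‖Complex.exp (-(k * (t * √t * x : ℝ) * Complex.I))‖ = 1 := by
      have := Complex.norm_exp_ofReal_mul_I (-(k * (t * √t * x)))
      rw [← this]
      congr 2
      push_cast
      ring
    have h2 : |t * √t * x| ≤ Real.pi := by
      rw [abs_mul, abs_of_pos hh, mul_comm, ← le_div_iff₀ hh, abs_le]
      exact ⟨hx.1.le, hx.2⟩
    have h3 := h t ht ht1 m hm _ h2
    have h4 : (t * √t * x) ^ 2 / t ^ 3 = x ^ 2 := by
      rw [mul_pow, mul_pow, Real.sq_sqrt ht.le]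
      field_simp
    rw [h4] at h3
    rwa [h1, mul_one]
  · rw [Set.indicator_of_notMem hx, norm_zero]
    positivity

theorem pairProb_nonneg {t : ℝ} (m k : ℕ) : 0 ≤ pairProb (Real.exp (-t)) m k := by
  unfold pairProb
  have := Real.exp_pos (-t)
  positivity

theorem localDensity_nonneg {n : ℕ} (hn : 1 ≤ n) (m : ℕ) : 0 ≤ localDensity n m :=
  div_nonneg (pairProb_nonneg _ _) (mul_nonneg (temp_pos hn).le (Real.sqrt_nonneg _))

theorem exists_localDensity_le : ∃ C : ℝ, 0 < C ∧ ∀ n m : ℕ, 1 ≤ n → temp n ≤ 1 →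
    1 ≤ m * temp n → localDensity n m ≤ C := by
  obtain ⟨C, hC, h⟩ := exists_norm_fourierKernel_le
  have hpi := Real.pi_pos
  refine ⟨C / 2, by positivity, fun n m hn ht1 hm => ?_⟩
  have ht := temp_pos hn
  have h1 := norm_integral_le_of_norm_le (integrable_inv_one_add_sq.const_mul C)
    (ae_of_all volume (h _ ht ht1 m hm (n - m)))
  have h0 : 0 ≤ 2 * Real.pi * (pairProb (Real.exp (-temp n)) m (n - m) / (temp n * √(temp n))) :=
    mul_nonneg (by positivity) (localDensity_nonneg hn m)
  rw [integral_fourierKernel ht, integral_const_mul, integral_univ_inv_one_add_sq,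
    Complex.norm_real, Real.norm_of_nonneg h0] at h1
  rw [localDensity]
  have h2 : 2 * (pairProb (Real.exp (-temp n)) m (n - m) / (temp n * √(temp n))) ≤ C :=
    le_of_mul_le_mul_left (by linarith) hpi
  linarith

theorem pairProb_le_one {q : ℝ} (hq0 : 0 < q) (hq1 : q < 1) (m k : ℕ) : pairProb q m k ≤ 1 := by
  have hpi := Real.pi_pos
  have h1 := integral_charFn hq0 hq1 m k
  have h2 : ‖∫ θ in (-Real.pi)..Real.pi, charFn q m θ * Complex.exp (-(k * θ * Complex.I))‖ ≤
      1 * |Real.pi - -Real.pi| := by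
    refine intervalIntegral.norm_integral_le_of_norm_le_const fun θ _ => ?_
    rw [norm_mul]
    have h1 : ‖Complex.exp (-(k * θ * Complex.I))‖ = 1 := by
      have := Complex.norm_exp_ofReal_mul_I (-(k * θ))
      rw [← this]
      congr 2
      push_cast
      ring
    rw [h1, mul_one]
    exact norm_charFn_le_one hq0 m θ
  rw [h1, Complex.norm_real, abs_of_pos (by linarith), Real.norm_eq_abs] at h2
  have h3 := (le_abs_self _).trans h2
  refine le_of_mul_le_mul_left ?_ (by positivity : 0 < 2 * Real.pi)
  linarith

theorem tendsto_temp_windowFilter : Tendsto (fun p => temp p.1) windowFilter (𝓝 0) :=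
  tendsto_temp.comp tendsto_fst_windowFilter

theorem tendsto_center_windowFilter : Tendsto (fun p => center p.1) windowFilter atTop :=
  tendsto_center.comp tendsto_fst_windowFilter

theorem eventually_one_le_windowFilter : ∀ᶠ p in windowFilter, 1 ≤ p.1 :=
  tendsto_fst_windowFilter.eventually_ge_atTop 1

theorem tendsto_sqrt_temp_windowFilter : Tendsto (fun p => √(temp p.1)) windowFilter (𝓝 0) := by
  have h := (Real.continuous_sqrt.tendsto 0).comp tendsto_temp_windowFilter
  rwa [Real.sqrt_zero] at h

theorem sqrt_temp_eq {n : ℕ} (hn : 1 ≤ n) : √(temp n) = √2 * Real.exp (-(center n / 2)) := by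
  have h : temp n = 2 * (Real.exp (-(center n / 2))) ^ 2 := by
    rw [← Real.exp_nat_mul, show ((2 : ℕ) : ℝ) * (-(center n / 2)) = -center n by push_cast; ring,
      exp_neg_center hn]
    ring
  rw [h, Real.sqrt_mul (by norm_num), Real.sqrt_sq (Real.exp_pos _).le]

theorem tendsto_center_pow_mul_sqrt_temp (r : ℕ) :
    Tendsto (fun n => center n ^ r * √(temp n)) atTop (𝓝 0) := by
  have h1 := (Real.tendsto_pow_mul_exp_neg_atTop_nhds_zero r).comp
    (tendsto_center.atTop_div_const (r := 2) (by norm_num))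
  have h2 := h1.const_mul (√2 * 2 ^ r)
  rw [mul_zero] at h2
  refine h2.congr' ?_
  filter_upwards [eventually_ge_atTop 1] with n hn
  rw [sqrt_temp_eq hn, Function.comp_apply, div_pow]
  field_simp

theorem eventually_one_le_mul_temp : ∀ᶠ p in windowFilter, 1 ≤ p.2 * temp p.1 := by
  filter_upwards [eventually_mem_window, tendsto_center_windowFilter.eventually_ge_atTop 2]
    with p hp h2
  linarith [hp.1]

/-- This guards the truncated subtraction `n - m`: on the window `m` is of order `√n log n`. -/
theorem eventually_le_windowFilter : ∀ᶠ p in windowFilter, p.2 ≤ p.1 := by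
  have h1 : Tendsto (fun p : ℕ × ℕ => center p.1 ^ 1 * √(temp p.1)) windowFilter (𝓝 0) :=
    (tendsto_center_pow_mul_sqrt_temp 1).comp tendsto_fst_windowFilter
  filter_upwards [eventually_mem_window, h1.eventually_lt_const (show (0 : ℝ) < 1 by norm_num),
    tendsto_temp_windowFilter.eventually_lt_const (show (0 : ℝ) < 1 by norm_num),
    eventually_one_le_windowFilter, tendsto_center_windowFilter.eventually_ge_atTop 0]
    with p hp h2 h3 h4 h5
  have ht := temp_pos h4
  set t := temp p.1
  have h6 : t ≤ √t := Real.le_sqrt_of_sq_le (by nlinarith)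
  have h7 : center p.1 * t ≤ 1 := by
    rw [pow_one] at h2
    have : center p.1 * t ≤ center p.1 * √t := by gcongr
    linarith
  have h8 : p.2 * t * t ≤ p.1 * t ^ 2 := by
    rw [mul_temp_sq h4]
    have h9 : p.2 * t * t ≤ 2 * center p.1 * t := by
      have := hp.2
      gcongr
    nlinarith [Real.pi_gt_three]
  have h10 : (p.2 : ℝ) ≤ p.1 := by
    refine le_of_mul_le_mul_right ?_ (by positivity : 0 < t ^ 2)
    linarith
  exact_mod_cast h10

/-- The variance of the limiting Gaussian law. -/
noncomputable def limitVar : ℝ := 2 * ∫ x in Set.Ioi 0, boseVar x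

theorem limitVar_pos : 0 < limitVar := mul_pos two_pos integral_boseVar_pos

theorem one_le_of_one_le_mul {m : ℕ} {t : ℝ} (h : 1 ≤ m * t) : 1 ≤ m := by
  refine Nat.one_le_iff_ne_zero.2 ?_
  rintro rfl
  norm_num at h

theorem tendsto_exp_center {a : ℝ} (ha : 0 < a) :
    Tendsto (fun p : ℕ × ℕ => Real.exp (-(a * center p.1))) windowFilter (𝓝 0) :=
  Real.tendsto_exp_neg_atTop_nhds_zero.comp (tendsto_center_windowFilter.const_mul_atTop ha)

theorem tendsto_varSize_window : Tendsto
    (fun p : ℕ × ℕ => (temp p.1 * √(temp p.1)) ^ 2 * varSize (temp p.1) p.2) windowFilter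
    (𝓝 limitVar) := by
  rw [tendsto_iff_norm_sub_tendsto_zero]
  have hlim := (tendsto_temp_windowFilter.const_mul 2).add
    ((tendsto_exp_center (a := 3 / 8) (by norm_num)).const_mul 64)
  simp only [mul_zero, add_zero] at hlim
  refine squeeze_zero' (Eventually.of_forall fun _ => norm_nonneg _) ?_ hlim
  filter_upwards [eventually_one_le_windowFilter, eventually_one_le_mul_temp,
    eventually_mem_window] with p h1 h2 h3
  have ht := temp_pos h1
  have h4 := abs_varSize_sub_le ht (one_le_of_one_le_mul h2)
  rw [mul_pow, Real.sq_sqrt ht.le, ← pow_succ, Real.norm_eq_abs]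
  refine h4.trans ?_
  gcongr
  linarith [h3.1]

/-- The mean must match `n - m` to within `o(t ^ (-3/2))`, which is finer than its leading
asymptotics. Since `n t ^ 2 = π ^ 2 / 3` exactly, only the Riemann sum error divided by `√t` and the
shift `m t √t` remain. The latter is at most `2 * center n * √t`, and the former is small because
`21/32 - 1/2 = 5/32 > 0`. -/
theorem tendsto_meanSize_window : Tendsto
    (fun p : ℕ × ℕ => temp p.1 * √(temp p.1) * (meanSize (temp p.1) p.2 - (p.1 - p.2 : ℕ)))
    windowFilter (𝓝 0) := by
  have h1 : Tendsto (fun p : ℕ × ℕ => center p.1 ^ 1 * √(temp p.1)) windowFilter (𝓝 0) :=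
    (tendsto_center_pow_mul_sqrt_temp 1).comp tendsto_fst_windowFilter
  have hlim := ((tendsto_sqrt_temp_windowFilter.const_mul 2).add
    ((tendsto_exp_center (a := 5 / 32) (by norm_num)).const_mul (128 / 7))).add (h1.const_mul 2)
  simp only [mul_zero, add_zero] at hlim
  refine squeeze_zero_norm' ?_ hlim
  filter_upwards [eventually_one_le_windowFilter, eventually_one_le_mul_temp,
    eventually_mem_window, eventually_le_windowFilter] with p h1 h2 h3 h4
  have ht := temp_pos h1
  have h5 := abs_meanSize_sub_le ht (one_le_of_one_le_mul h2)
  have h6 := mul_temp_sq h1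
  have h7 := sqrt_temp_eq h1
  set t := temp p.1
  set L := center p.1
  have hr : 0 < √t := Real.sqrt_pos.2 ht
  have hrr : √t * √t = t := Real.mul_self_sqrt ht.le
  rw [Nat.cast_sub h4]
  have h8 : t * √t * (meanSize t p.2 - (p.1 - p.2)) =
      (t ^ 2 * meanSize t p.2 - Real.pi ^ 2 / 3) / √t + p.2 * t * √t := by
    rw [← h6]
    field_simp
    have : √t ^ 2 = t := by rw [sq, hrr]
    rw [this]
    ring
  rw [h8]
  have h9 : ‖p.2 * t * √t‖ ≤ 2 * (L ^ 1 * √t) := by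
    rw [Real.norm_of_nonneg (by positivity), pow_one, ← mul_assoc]
    have := h3.2
    gcongr
  have h10 : ‖(t ^ 2 * meanSize t p.2 - Real.pi ^ 2 / 3) / √t‖ ≤
      2 * √t + 128 / 7 * Real.exp (-(5 / 32 * L)) := by
    rw [norm_div, Real.norm_eq_abs, Real.norm_of_nonneg hr.le, div_le_iff₀ hr]
    refine h5.trans ?_
    rw [add_mul, mul_assoc, hrr]
    gcongr 2 * t + ?_
    rw [mul_assoc]
    gcongr
    rw [h7]
    have hs : 1 ≤ √2 := Real.one_le_sqrt.2 (by norm_num)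
    calc Real.exp (-(7 / 8) * (p.2 * t)) ≤ Real.exp (-(21 / 32) * L) := by
          apply Real.exp_le_exp.2
          linarith [h3.1]
      _ = Real.exp (-(5 / 32 * L)) * Real.exp (-(L / 2)) := by
          rw [← Real.exp_add]; ring_nf
      _ ≤ Real.exp (-(5 / 32 * L)) * (√2 * Real.exp (-(L / 2))) := by
          gcongr
          exact le_mul_of_one_le_left (Real.exp_pos _).le hs
  exact (norm_add_le _ _).trans (add_le_add h10 h9)

theorem tendsto_pow_mul_window : Tendsto
    (fun p : ℕ × ℕ => (p.2 : ℝ) ^ 4 * (temp p.1 * √(temp p.1)) ^ 3) windowFilter (𝓝 0) := by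
  have h1 : Tendsto (fun p : ℕ × ℕ => center p.1 ^ 4 * √(temp p.1)) windowFilter (𝓝 0) :=
    (tendsto_center_pow_mul_sqrt_temp 4).comp tendsto_fst_windowFilter
  have hlim := h1.const_mul 16
  rw [mul_zero] at hlim
  refine squeeze_zero_norm' ?_ hlim
  filter_upwards [eventually_one_le_windowFilter, eventually_mem_window] with p h1 h3
  have ht := temp_pos h1
  rw [Real.norm_of_nonneg (by positivity)]
  set t := temp p.1
  have hrr : √t ^ 2 = t := Real.sq_sqrt ht.le
  have h2 : (p.2 : ℝ) ^ 4 * (t * √t) ^ 3 = (p.2 * t) ^ 4 * √t := by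
    calc (p.2 : ℝ) ^ 4 * (t * √t) ^ 3 = (p.2 : ℝ) ^ 4 * t ^ 3 * (√t ^ 2) * √t := by ring
      _ = _ := by rw [hrr]; ring
  rw [h2]
  have := h3.2
  calc (p.2 * t) ^ 4 * √t ≤ (2 * center p.1) ^ 4 * √t := by gcongr
    _ = _ := by ring

/-- Local limit theorem, uniformly over typical peaks. -/
theorem exists_tendsto_localDensity : ∃ c : ℝ, 0 < c ∧
    Tendsto (fun p : ℕ × ℕ => localDensity p.1 p.2) windowFilter (𝓝 c) := by
  obtain ⟨C, hC, hK⟩ := exists_norm_fourierKernel_le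
  have hpi := Real.pi_pos
  have hs := limitVar_pos
  have hev : ∀ᶠ p in windowFilter, temp p.1 ≤ 1 :=
    (tendsto_temp_windowFilter.eventually_lt_const (show (0 : ℝ) < 1 by norm_num)).mono
      fun _ h => h.le
  have hdct : Tendsto (fun p : ℕ × ℕ => ∫ x, fourierKernel (temp p.1) p.2 (p.1 - p.2) x)
      windowFilter (𝓝 (∫ x : ℝ, Complex.exp ((-(limitVar * x ^ 2 / 2) : ℝ)))) := by
    refine tendsto_integral_filter_of_dominated_convergence (fun x => C * (1 + x ^ 2)⁻¹)
      (Eventually.of_forall fun p => (measurable_fourierKernel _ _ _).aestronglyMeasurable)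
      ?_ (integrable_inv_one_add_sq.const_mul C) (ae_of_all _ fun x => ?_)
    · filter_upwards [eventually_one_le_windowFilter, hev, eventually_one_le_mul_temp]
        with p h1 h2 h3
      exact ae_of_all _ fun x => hK _ (temp_pos h1) h2 _ h3 _ x
    · have h1 := tendsto_charFn (l := windowFilter) (t := fun p => temp p.1)
        (h := fun p => temp p.1 * √(temp p.1)) (m := fun p => p.2) (k := fun p => p.1 - p.2)
        (eventually_one_le_windowFilter.mono fun p h => temp_pos h)
        (eventually_one_le_windowFilter.mono fun p h =>
          mul_pos (temp_pos h) (Real.sqrt_pos.2 (temp_pos h)))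
        eventually_one_le_mul_temp tendsto_pow_mul_window tendsto_meanSize_window
        tendsto_varSize_window x
      refine h1.congr' ?_
      -- For fixed `x` the cut-off `π / (t √t)` eventually exceeds `|x|`, so the indicator in
      -- `fourierKernel` equals `1`.
      have h0 : Tendsto (fun p : ℕ × ℕ => temp p.1 * √(temp p.1) * |x|) windowFilter (𝓝 0) := by
        simpa using (tendsto_temp_windowFilter.mul tendsto_sqrt_temp_windowFilter).mul_const |x|
      filter_upwards [eventually_one_le_windowFilter, h0.eventually_lt_const hpi] with p h1 h2
      have ht := temp_pos h1
      have hh : 0 < temp p.1 * √(temp p.1) := mul_pos ht (Real.sqrt_pos.2 ht)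
      rw [fourierKernel, Set.indicator_of_mem]
      have h3 : |x| < Real.pi / (temp p.1 * √(temp p.1)) := by
        rw [lt_div_iff₀ hh]; linarith
      exact ⟨(abs_lt.1 h3).1, (abs_lt.1 h3).2.le⟩
  have hgauss : (∫ x : ℝ, Complex.exp ((-(limitVar * x ^ 2 / 2) : ℝ))) =
      ((√(Real.pi / (limitVar / 2)) : ℝ) : ℂ) := by
    rw [← integral_gaussian, ← integral_complex_ofReal]
    congr 1
    ext x
    rw [← Complex.ofReal_exp]
    ring_nf
  rw [hgauss] at hdct
  refine ⟨√(Real.pi / (limitVar / 2)) / (2 * Real.pi), by positivity, ?_⟩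
  have h2 := ((Complex.continuous_re.tendsto _).comp hdct).div_const (2 * Real.pi)
  rw [Complex.ofReal_re] at h2
  refine h2.congr' ?_
  filter_upwards [eventually_one_le_windowFilter] with p h1
  rw [Function.comp_apply, integral_fourierKernel (temp_pos h1), Complex.ofReal_re, localDensity]
  field_simp

/-! ### The tail product and its Gumbel limit -/

/-- The probability that two independent random partitions with parts at most `n`
have all their parts at most `m`. -/
noncomputable def tailProd (n m : ℕ) : ℝ :=
  ∏ j ∈ Finset.Ioc m n, (1 - Real.exp (-temp n) ^ j) ^ 2

theorem one_sub_mem {t : ℝ} (ht : 0 < t) {j : ℕ} (hj : 1 ≤ j) :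
    0 < 1 - Real.exp (-t) ^ j ∧ 1 - Real.exp (-t) ^ j ≤ 1 :=
  ⟨one_sub_exp_pow_pos ht hj, by linarith [pow_pos (Real.exp_pos (-t)) j]⟩

theorem tailProd_pos {n : ℕ} (hn : 1 ≤ n) (m : ℕ) : 0 < tailProd n m :=
  Finset.prod_pos fun j hj => pow_pos
    (one_sub_mem (temp_pos hn) (by have := (Finset.mem_Ioc.1 hj).1; omega)).1 2

theorem tailProd_le_one {n : ℕ} (hn : 1 ≤ n) (m : ℕ) : tailProd n m ≤ 1 :=
  Finset.prod_le_one (fun _ _ => sq_nonneg _) fun j hj => by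
    have h := one_sub_mem (temp_pos hn) (j := j) (by have := (Finset.mem_Ioc.1 hj).1; omega)
    exact pow_le_one₀ h.1.le h.2

theorem tailProd_of_le {n m : ℕ} (h : n ≤ m) : tailProd n m = 1 := by
  rw [tailProd, Finset.Ioc_eq_empty (by omega), Finset.prod_empty]

/-- The factor `q ^ m * tailProd n m` is, up to `localDensity`, the weight of the peak `m`; this
identity is what makes the peak weights nearly increments of a distribution function. -/
theorem tailProd_sub {n m : ℕ} (hm : 1 ≤ m) (hmn : m ≤ n) :
    tailProd n m - tailProd n (m - 1) =
      Real.exp (-temp n) ^ m * tailProd n m * (2 - Real.exp (-temp n) ^ m) := by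
  have h : Finset.Ioc (m - 1) n = insert m (Finset.Ioc m n) := by
    ext j; simp only [Finset.mem_Ioc, Finset.mem_insert]; omega
  have h2 : tailProd n (m - 1) = (1 - Real.exp (-temp n) ^ m) ^ 2 * tailProd n m := by
    rw [tailProd, h, Finset.prod_insert (by simp), tailProd]
  rw [h2]
  ring

theorem tailProd_mono {n : ℕ} (hn : 1 ≤ n) : Monotone (tailProd n) := by
  refine monotone_nat_of_le_succ fun m => ?_
  rcases le_total n m with h | h
  · rw [tailProd_of_le h, tailProd_of_le (by omega)]
  rcases eq_or_lt_of_le h with rfl | h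
  · rw [tailProd_of_le le_rfl, tailProd_of_le (by omega)]
  have h1 := tailProd_sub (m := m + 1) (by omega) h
  have h2 := tailProd_pos hn (m + 1)
  have h3 := one_sub_mem (temp_pos hn) (j := m + 1) (by omega)
  rw [Nat.add_sub_cancel] at h1
  have h4 : 0 ≤ Real.exp (-temp n) ^ (m + 1) * tailProd n (m + 1) *
      (2 - Real.exp (-temp n) ^ (m + 1)) :=
    mul_nonneg (by positivity) (by linarith [h3.1])
  linarith

theorem geom_Ioc (q : ℝ) {a b : ℕ} (h : a ≤ b) :
    (1 - q) * ∑ j ∈ Finset.Ioc a b, q ^ j = q ^ (a + 1) - q ^ (b + 1) := by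
  induction b, h using Nat.le_induction with
  | base => simp
  | succ b hb ih =>
    rw [← Finset.insert_Ioc_right_eq_Ioc_add_one (by omega), Finset.sum_insert (by simp), mul_add,
      ih]
    ring

theorem exp_neg_two_mul (x : ℝ) : Real.exp (-2 * x) = Real.exp (-x) ^ 2 := by
  rw [← Real.exp_nat_mul]
  congr 1
  push_cast
  ring

/-- From `1 - x ≤ exp (-x)` and a finite geometric sum; the term `q ^ (n + 1)` is there because the
product stops at `n`. -/
theorem tailProd_le_exp {n : ℕ} (hn : 1 ≤ n) (m : ℕ) :
    tailProd n m ≤ Real.exp (-2 * ((Real.exp (-temp n) ^ (m + 1) - Real.exp (-temp n) ^ (n + 1)) /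
      (1 - Real.exp (-temp n)))) := by
  have ht := temp_pos hn
  have hq1 : Real.exp (-temp n) < 1 := Real.exp_lt_one_iff.2 (by linarith)
  have hq0 := Real.exp_pos (-temp n)
  set q := Real.exp (-temp n) with hq
  rcases le_total n m with h | h
  · rw [tailProd_of_le h]
    apply Real.one_le_exp
    have h1 : q ^ (m + 1) ≤ q ^ (n + 1) := pow_le_pow_of_le_one hq0.le hq1.le (by omega)
    have : (q ^ (m + 1) - q ^ (n + 1)) / (1 - q) ≤ 0 :=
      div_nonpos_of_nonpos_of_nonneg (by linarith) (by linarith)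
    linarith
  · rw [← geom_Ioc q h, mul_div_cancel_left₀ _ (by linarith), Finset.mul_sum, Real.exp_sum, tailProd]
    refine Finset.prod_le_prod (fun _ _ => sq_nonneg _) fun j hj => ?_
    rw [← hq]
    have h1 := one_sub_mem ht (j := j) (by have := (Finset.mem_Ioc.1 hj).1; omega)
    have h2 := Real.add_one_le_exp (-(q ^ j))
    rw [exp_neg_two_mul]
    have := h1.1
    gcongr
    linarith

/-- From `1 - x ≥ exp (-x / (1 - x))`, with the denominator replaced by its smallest value, at `j =
m + 1`. -/
theorem exp_le_tailProd {n : ℕ} (hn : 1 ≤ n) (m : ℕ) :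
    Real.exp (-2 * (Real.exp (-temp n) ^ (m + 1) / (1 - Real.exp (-temp n)) /
      (1 - Real.exp (-temp n) ^ (m + 1)))) ≤ tailProd n m := by
  have ht := temp_pos hn
  have hq1 : Real.exp (-temp n) < 1 := Real.exp_lt_one_iff.2 (by linarith)
  have hq0 := Real.exp_pos (-temp n)
  have hm1 := one_sub_mem ht (j := m + 1) (by omega)
  set q := Real.exp (-temp n) with hq
  rcases le_total n m with h | h
  · rw [tailProd_of_le h]
    apply Real.exp_le_one_iff.2
    have h0 : 0 < 1 - q := by linarith
    have : 0 ≤ q ^ (m + 1) / (1 - q) / (1 - q ^ (m + 1)) :=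
      div_nonneg (by positivity) hm1.1.le
    linarith
  · have hgeo := geom_Ioc q h
    have h0 : 0 < 1 - q := by linarith
    have h1 : ∑ j ∈ Finset.Ioc m n, q ^ j ≤ q ^ (m + 1) / (1 - q) := by
      rw [le_div_iff₀ h0]
      linarith [pow_pos hq0 (n + 1)]
    have h2 : Real.exp (-2 * (q ^ (m + 1) / (1 - q) / (1 - q ^ (m + 1)))) ≤
        Real.exp (∑ j ∈ Finset.Ioc m n, -2 * (q ^ j / (1 - q ^ (m + 1)))) := by
      rw [← Finset.mul_sum, ← Finset.sum_div]
      apply Real.exp_le_exp.2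
      have := div_le_div_of_nonneg_right h1 hm1.1.le
      linarith
    refine h2.trans ?_
    rw [Real.exp_sum, tailProd]
    refine Finset.prod_le_prod (fun _ _ => (Real.exp_pos _).le) fun j hj => ?_
    rw [← hq]
    rw [Finset.mem_Ioc] at hj
    have h3 := one_sub_mem ht (j := j) (by omega)
    rw [← hq] at h3
    rw [exp_neg_two_mul]
    gcongr
    have h5 : q ^ j / (1 - q ^ j) ≤ q ^ j / (1 - q ^ (m + 1)) := by
      have h6 : q ^ j ≤ q ^ (m + 1) := pow_le_pow_of_le_one hq0.le hq1.le (by omega)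
      have := hm1.1
      gcongr
    have h7 := Real.add_one_le_exp (q ^ j / (1 - q ^ j))
    have h8 : q ^ j / (1 - q ^ j) + 1 = 1 / (1 - q ^ j) := by
      have := h3.1.ne'
      field_simp
      ring
    rw [h8] at h7
    calc Real.exp (-(q ^ j / (1 - q ^ (m + 1)))) ≤ Real.exp (-(q ^ j / (1 - q ^ j))) :=
          Real.exp_le_exp.2 (by linarith)
      _ = (Real.exp (q ^ j / (1 - q ^ j)))⁻¹ := Real.exp_neg _
      _ ≤ (1 / (1 - q ^ j))⁻¹ := inv_anti₀ (by have := h3.1; positivity) h7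
      _ = 1 - q ^ j := by simp

/-- The largest peak whose normalised value is at most `v`. -/
noncomputable def level (n : ℕ) (v : ℝ) : ℕ := ⌊(center n + v) / temp n⌋₊

theorem div_one_sub_exp_neg_mem {t : ℝ} (ht : 0 < t) :
    1 ≤ t / (1 - Real.exp (-t)) ∧ t / (1 - Real.exp (-t)) ≤ 1 + t := by
  have h0 : 0 < 1 - Real.exp (-t) := sub_pos.2 (Real.exp_lt_one_iff.2 (by linarith))
  refine ⟨?_, ?_⟩
  · rw [le_div_iff₀ h0]
    linarith [Real.add_one_le_exp (-t)]
  · rw [div_le_iff₀ h0]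
    exact le_one_add_mul_one_sub_exp_neg t

theorem pow_level_le {n : ℕ} (hn : 1 ≤ n) (v : ℝ) :
    Real.exp (-temp n) ^ (level n v + 1) ≤ temp n / 2 * Real.exp (-v) := by
  have ht := temp_pos hn
  have h : (center n + v) < (level n v + 1) * temp n := by
    rw [← div_lt_iff₀ ht]; exact Nat.lt_floor_add_one _
  rw [← exp_neg_center hn, ← Real.exp_add, ← Real.exp_nat_mul]
  apply Real.exp_le_exp.2
  push_cast
  linarith

theorem le_pow_level {n : ℕ} (hn : 1 ≤ n) {v : ℝ} (hv : 0 ≤ center n + v) :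
    temp n / 2 * Real.exp (-v) * Real.exp (-temp n) ≤ Real.exp (-temp n) ^ (level n v + 1) := by
  have ht := temp_pos hn
  have h : level n v * temp n ≤ center n + v := by
    rw [← le_div_iff₀ ht]; exact Nat.floor_le (by positivity)
  rw [← exp_neg_center hn, ← Real.exp_add, ← Real.exp_add, ← Real.exp_nat_mul]
  apply Real.exp_le_exp.2
  push_cast
  linarith

/-- Truncating the product at `n` is harmless: `n t = π ^ 2 / (3 t) ≥ 3 / t`, so this term is
exponentially small in `1 / t`. -/
theorem pow_size_le {n : ℕ} (hn : 1 ≤ n) :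
    Real.exp (-temp n) ^ (n + 1) ≤ temp n ^ 2 := by
  have ht := temp_pos hn
  have h1 := mul_temp_sq hn
  have h2 : Real.exp (-temp n) ^ (n + 1) ≤ Real.exp (-(3 / temp n)) := by
    rw [← Real.exp_nat_mul]
    apply Real.exp_le_exp.2
    push_cast
    have h3 : 3 / temp n ≤ n * temp n := by
      rw [div_le_iff₀ ht]
      nlinarith [Real.pi_gt_three]
    linarith
  refine h2.trans ?_
  have h4 := Real.pow_div_factorial_le_exp (3 / temp n) (by positivity) 2
  rw [Real.exp_neg]
  rw [inv_le_comm₀ (Real.exp_pos _) (by positivity)]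
  refine le_trans ?_ h4
  rw [div_pow]
  norm_num [Nat.factorial]
  rw [div_div, inv_eq_one_div, div_le_div_iff₀ (by positivity) (by positivity)]
  nlinarith [sq_nonneg (temp n)]

theorem tailProd_level_le {n : ℕ} (hn : 1 ≤ n) {v : ℝ} (hv : 0 ≤ center n + v) :
    tailProd n (level n v) ≤
      Real.exp (-(Real.exp (-v) * Real.exp (-temp n)) + 2 * (temp n * (1 + temp n))) := by
  have ht := temp_pos hn
  refine (tailProd_le_exp hn _).trans (Real.exp_le_exp.2 ?_)
  have h1 := div_one_sub_exp_neg_mem ht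
  have h2 := le_pow_level hn hv
  have h3 := pow_size_le hn
  have h0 : 0 < 1 - Real.exp (-temp n) := sub_pos.2 (Real.exp_lt_one_iff.2 (by linarith))
  rw [sub_div]
  have h4 : Real.exp (-v) * Real.exp (-temp n) / 2 ≤
      Real.exp (-temp n) ^ (level n v + 1) / (1 - Real.exp (-temp n)) := by
    calc Real.exp (-v) * Real.exp (-temp n) / 2 ≤
        Real.exp (-v) * Real.exp (-temp n) / 2 * (temp n / (1 - Real.exp (-temp n))) :=
          le_mul_of_one_le_right (by positivity) h1.1
      _ = temp n / 2 * Real.exp (-v) * Real.exp (-temp n) / (1 - Real.exp (-temp n)) := by ring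
      _ ≤ _ := by gcongr
  have h5 : Real.exp (-temp n) ^ (n + 1) / (1 - Real.exp (-temp n)) ≤ temp n * (1 + temp n) := by
    calc Real.exp (-temp n) ^ (n + 1) / (1 - Real.exp (-temp n)) ≤
        temp n ^ 2 / (1 - Real.exp (-temp n)) := by gcongr
      _ = temp n * (temp n / (1 - Real.exp (-temp n))) := by ring
      _ ≤ _ := by gcongr; exact h1.2
  linarith

theorem le_tailProd_level {n : ℕ} (hn : 1 ≤ n) {v : ℝ} (hv : temp n / 2 * Real.exp (-v) < 1) :
    Real.exp (-(Real.exp (-v) * (1 + temp n) / (1 - temp n / 2 * Real.exp (-v)))) ≤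
      tailProd n (level n v) := by
  have ht := temp_pos hn
  refine le_trans (Real.exp_le_exp.2 ?_) (exp_le_tailProd hn _)
  have h1 := div_one_sub_exp_neg_mem ht
  have h2 := pow_level_le hn v
  have h0 : 0 < 1 - Real.exp (-temp n) := sub_pos.2 (Real.exp_lt_one_iff.2 (by linarith))
  have h3 : 0 < 1 - temp n / 2 * Real.exp (-v) := by linarith
  have h4 : Real.exp (-temp n) ^ (level n v + 1) / (1 - Real.exp (-temp n)) ≤
      Real.exp (-v) * (1 + temp n) / 2 := by
    calc _ ≤ temp n / 2 * Real.exp (-v) / (1 - Real.exp (-temp n)) := by gcongr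
      _ = Real.exp (-v) * (temp n / (1 - Real.exp (-temp n))) / 2 := by ring
      _ ≤ _ := by gcongr; exact h1.2
  have h5 : Real.exp (-temp n) ^ (level n v + 1) / (1 - Real.exp (-temp n)) /
      (1 - Real.exp (-temp n) ^ (level n v + 1)) ≤
      Real.exp (-v) * (1 + temp n) / 2 / (1 - temp n / 2 * Real.exp (-v)) := by gcongr
  have h6 : Real.exp (-v) * (1 + temp n) / 2 / (1 - temp n / 2 * Real.exp (-v)) =
    Real.exp (-v) * (1 + temp n) / (1 - temp n / 2 * Real.exp (-v)) / 2 := by ring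
  linarith

/-- At `m = level n v` one has `q ^ (m + 1) ≈ (t / 2) exp (-v)`, so `2 q ^ (m + 1) / (1 - q) → exp
(-v)`. The factor `2` inside the logarithm of `center` comes from the two sides of the peak. -/
theorem tendsto_tailProd_level (v : ℝ) :
    Tendsto (fun n => tailProd n (level n v)) atTop (𝓝 (Real.exp (-Real.exp (-v)))) := by
  have ht := tendsto_temp
  have hup : Tendsto (fun n => Real.exp (-(Real.exp (-v) * Real.exp (-temp n)) +
      2 * (temp n * (1 + temp n)))) atTop (𝓝 (Real.exp (-Real.exp (-v)))) := by
    have h : ContinuousAt (fun t : ℝ => Real.exp (-(Real.exp (-v) * Real.exp (-t)) +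
      2 * (t * (1 + t)))) 0 := by fun_prop
    have h2 := h.tendsto.comp ht
    simpa [Function.comp_def] using h2
  have hlow : Tendsto (fun n => Real.exp (-(Real.exp (-v) * (1 + temp n) /
      (1 - temp n / 2 * Real.exp (-v))))) atTop (𝓝 (Real.exp (-Real.exp (-v)))) := by
    have h : ContinuousAt (fun t : ℝ => Real.exp (-(Real.exp (-v) * (1 + t) /
      (1 - t / 2 * Real.exp (-v))))) 0 := by
      refine Real.continuous_exp.continuousAt.comp (ContinuousAt.neg (ContinuousAt.div ?_ ?_ ?_))
      · fun_prop
      · fun_prop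
      · simp
    have h2 := h.tendsto.comp ht
    simpa [Function.comp_def] using h2
  have hlt : Tendsto (fun n => temp n / 2 * Real.exp (-v)) atTop (𝓝 0) := by
    simpa using (ht.div_const 2).mul_const (Real.exp (-v))
  refine tendsto_of_tendsto_of_tendsto_of_le_of_le' hlow hup ?_ ?_
  · filter_upwards [eventually_ge_atTop 1, hlt.eventually_lt_const zero_lt_one] with n h1 h2
    exact le_tailProd_level h1 h2
  · filter_upwards [eventually_ge_atTop 1, tendsto_center.eventually_ge_atTop (-v)] with n h1 h2
    exact tailProd_level_le h1 (by linarith)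

theorem one_sub_tailProd_level_le {n : ℕ} (hn : 1 ≤ n) (ht1 : temp n ≤ 1) {v : ℝ} (hv : 0 ≤ v) :
    1 - tailProd n (level n v) ≤ 4 * Real.exp (-v) := by
  have ht := temp_pos hn
  have hev : Real.exp (-v) ≤ 1 := Real.exp_le_one_iff.2 (by linarith)
  have h0 := Real.exp_pos (-v)
  have h1 : temp n / 2 * Real.exp (-v) ≤ 1 / 2 := by nlinarith
  have h2 := le_tailProd_level hn (v := v) (by linarith)
  have h3 : Real.exp (-v) * (1 + temp n) / (1 - temp n / 2 * Real.exp (-v)) ≤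
      4 * Real.exp (-v) := by
    rw [div_le_iff₀ (by linarith)]
    nlinarith
  have h4 := Real.add_one_le_exp
    (-(Real.exp (-v) * (1 + temp n) / (1 - temp n / 2 * Real.exp (-v))))
  linarith

theorem tailProd_level_le_of_le_one {n : ℕ} (hn : 1 ≤ n) (ht1 : temp n ≤ 1) {v : ℝ}
    (hv : 0 ≤ center n + v) :
    tailProd n (level n v) ≤ Real.exp 4 * Real.exp (-(Real.exp (-v) * Real.exp (-1))) := by
  have ht := temp_pos hn
  refine (tailProd_level_le hn hv).trans ?_
  rw [← Real.exp_add (4 : ℝ)]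
  apply Real.exp_le_exp.2
  have h1 : Real.exp (-1) ≤ Real.exp (-temp n) := Real.exp_le_exp.2 (by linarith)
  have h2 : Real.exp (-v) * Real.exp (-1) ≤ Real.exp (-v) * Real.exp (-temp n) := by gcongr
  nlinarith

/-- The double exponential is weakened to a single one by `exp (-y) ≤ 1 / y`, which is enough for
domination in the lower tail. -/
theorem tailProd_level_le_exp {n : ℕ} (hn : 1 ≤ n) (ht1 : temp n ≤ 1) {v : ℝ}
    (hv : 0 ≤ center n + v) : tailProd n (level n v) ≤ Real.exp 5 * Real.exp v := by
  refine (tailProd_level_le_of_le_one hn ht1 hv).trans ?_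
  have h1 : Real.exp (-(Real.exp (-v) * Real.exp (-1))) ≤ Real.exp (v + 1) := by
    have h2 := Real.add_one_le_exp (Real.exp (-v) * Real.exp (-1))
    have h3 : Real.exp (v + 1) = (Real.exp (-v) * Real.exp (-1))⁻¹ := by
      rw [← Real.exp_add, ← Real.exp_neg]; ring_nf
    rw [h3, Real.exp_neg]
    apply inv_anti₀ (by positivity)
    linarith
  calc _ ≤ Real.exp 4 * Real.exp (v + 1) := by gcongr
    _ = _ := by rw [← Real.exp_add, ← Real.exp_add]; ring_nf

/-- Peaks of order `1 / temp n` are exponentially unlikely. -/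
theorem exists_tailProd_level_small : ∃ K : ℝ, 0 < K ∧ ∀ n : ℕ, 1 ≤ n → temp n ≤ 1 →
    1 / (temp n * √(temp n)) * tailProd n (level n (1 - center n)) ≤ K * temp n := by
  -- The level `1 - center n` corresponds to `m t ≤ 1`. As `exp (center n) = 2 / t`, the exponent in
  -- the bound is `-a / t`, which beats the trivial bound `t ^ (-3/2)` on `localDensity`.
  set a := 2 * Real.exp (-2) with ha
  have ha0 : 0 < a := by positivity
  refine ⟨Real.exp 4 * (6 / a ^ 3), by positivity, fun n hn ht1 => ?_⟩
  have ht := temp_pos hn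
  have h1 := tailProd_level_le_of_le_one hn ht1 (v := 1 - center n) (by linarith)
  have h2 : Real.exp (-(1 - center n)) * Real.exp (-1) = a / temp n := by
    have h3 : Real.exp (center n) = 2 / temp n := by
      rw [← inv_inv (Real.exp (center n)), ← Real.exp_neg, exp_neg_center hn, inv_div]
    rw [← Real.exp_add, show -(1 - center n) + -1 = center n + -2 by ring, Real.exp_add, h3, ha]
    ring
  rw [h2] at h1
  set t := temp n
  have h4 := Real.pow_div_factorial_le_exp (a / t) (by positivity) 3
  have h5 : Real.exp (-(a / t)) ≤ 6 / a ^ 3 * t ^ 3 := by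
    rw [Real.exp_neg]
    refine (inv_anti₀ (by positivity) h4).trans (le_of_eq ?_)
    norm_num [Nat.factorial]
    field_simp
  have hr : 0 < √t := Real.sqrt_pos.2 ht
  have hrt : t ≤ √t := Real.le_sqrt_of_sq_le (by nlinarith)
  calc 1 / (t * √t) * tailProd n (level n (1 - center n)) ≤
      1 / (t * t) * (Real.exp 4 * (6 / a ^ 3 * t ^ 3)) := by
        have h0 := (tailProd_pos hn (level n (1 - center n))).le
        gcongr
        exact h1.trans (by gcongr)
    _ = _ := by field_simp

/-! ### Peak weights as perturbed increments of the tail product -/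

/-- The normalising factor that turns `peakCount n` into a nearly probability weight. -/
noncomputable def normFactor (n : ℕ) : ℝ :=
  Real.exp (-temp n) ^ n * (∏ j ∈ Finset.Icc 1 n, (1 - Real.exp (-temp n) ^ j) ^ 2) /
    (temp n * √(temp n))

theorem normFactor_pos {n : ℕ} (hn : 1 ≤ n) : 0 < normFactor n := by
  have ht := temp_pos hn
  refine div_pos (mul_pos (pow_pos (Real.exp_pos _) _) (Finset.prod_pos fun j hj => ?_))
    (mul_pos ht (Real.sqrt_pos.2 ht))
  exact pow_pos (one_sub_mem ht (Finset.mem_Icc.1 hj).1).1 2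

/-- The normalised number of unimodal sequences of size `n` with peak at most `N`. -/
noncomputable def cumWeight (n N : ℕ) : ℝ :=
  ∑ m ∈ Finset.Icc 1 N, peakCount n m * normFactor n

/-- The normalised probability weight of the peak, relative to the increments of `tailProd`. -/
noncomputable def peakRatio (n m : ℕ) : ℝ :=
  localDensity n m / (2 - Real.exp (-temp n) ^ m)

/-- The increments of `tailProd`. -/
noncomputable def incr (n m : ℕ) : ℝ := tailProd n m - tailProd n (m - 1)

theorem incr_nonneg {n : ℕ} (hn : 1 ≤ n) (m : ℕ) : 0 ≤ incr n m :=
  sub_nonneg.2 (tailProd_mono hn (Nat.sub_le _ _))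

/-- The factor `normFactor n` does not depend on `m`. Splitting its product at `m` gives the
normalisation of `pairProb` for `j ≤ m` and leaves `tailProd n m`. For `m > n` both sides vanish. -/
theorem peakCount_mul_normFactor {n m : ℕ} (hn : 1 ≤ n) (hm : 1 ≤ m) :
    peakCount n m * normFactor n = incr n m * peakRatio n m := by
  have ht := temp_pos hn
  rcases lt_or_ge n m with h | h
  · rw [peakCount_eq_zero (Or.inr h), incr, tailProd_of_le h.le, tailProd_of_le (by omega)]
    simp
  · have hq := one_sub_mem ht hm
    rw [peakCount_eq hm h, incr, tailProd_sub hm h, peakRatio, localDensity, pairProb, normFactor,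
      tailProd]
    have h1 : (∏ j ∈ Finset.Icc 1 n, (1 - Real.exp (-temp n) ^ j) ^ 2) =
        (∏ j ∈ Finset.Icc 1 m, (1 - Real.exp (-temp n) ^ j) ^ 2) *
          ∏ j ∈ Finset.Ioc m n, (1 - Real.exp (-temp n) ^ j) ^ 2 := by
      rw [← Finset.prod_union]
      · congr 1
        ext j
        simp only [Finset.mem_Icc, Finset.mem_union, Finset.mem_Ioc]
        omega
      · rw [Finset.disjoint_left]
        intro j hj hj2
        simp only [Finset.mem_Icc, Finset.mem_Ioc] at hj hj2
        omega
    have h2 : Real.exp (-temp n) ^ n = Real.exp (-temp n) ^ m * Real.exp (-temp n) ^ (n - m) := by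
      rw [← pow_add]; congr 1; omega
    rw [h1, h2]
    have h3 : 2 - Real.exp (-temp n) ^ m ≠ 0 := by linarith [hq.1]
    field_simp

theorem cumWeight_eq {n : ℕ} (hn : 1 ≤ n) (N : ℕ) :
    cumWeight n N = ∑ m ∈ Finset.Icc 1 N, incr n m * peakRatio n m :=
  Finset.sum_congr rfl fun _ hm => peakCount_mul_normFactor hn (Finset.mem_Icc.1 hm).1

theorem sum_incr (n N : ℕ) : ∑ m ∈ Finset.Icc 1 N, incr n m = tailProd n N - tailProd n 0 := by
  induction N with
  | zero => simp
  | succ N ih =>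
    rw [Finset.sum_Icc_succ_top (by omega), ih, incr, Nat.add_sub_cancel]
    ring

theorem sum_incr_le (n N A : ℕ) :
    ∑ m ∈ Finset.Icc 1 N, incr n m * (if m ≤ A then 1 else 0) =
      tailProd n (min N A) - tailProd n 0 := by
  rw [← sum_incr]
  simp_rw [mul_ite, mul_one, mul_zero]
  rw [← Finset.sum_filter]
  refine Finset.sum_congr ?_ fun _ _ => rfl
  ext m
  simp only [Finset.mem_filter, Finset.mem_Icc, le_min_iff]
  omega

theorem sum_incr_le_tailProd {n : ℕ} (hn : 1 ≤ n) (N A : ℕ) :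
    ∑ m ∈ Finset.Icc 1 N, incr n m * (if m ≤ A then 1 else 0) ≤ tailProd n A := by
  rw [sum_incr_le]
  linarith [tailProd_mono hn (min_le_right N A), tailProd_pos hn 0]

theorem sum_incr_gt_le {n : ℕ} (hn : 1 ≤ n) (N A : ℕ) :
    ∑ m ∈ Finset.Icc 1 N, incr n m * (if A < m then 1 else 0) ≤ 1 - tailProd n A := by
  have h : ∀ m, incr n m * (if A < m then (1 : ℝ) else 0) =
      incr n m - incr n m * (if m ≤ A then 1 else 0) := by
    intro m
    rcases le_or_gt m A with h | h
    · rw [if_neg (by omega), if_pos h]; ring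
    · rw [if_pos h, if_neg (by omega)]; ring
  simp_rw [h]
  rw [Finset.sum_sub_distrib, sum_incr, sum_incr_le]
  rcases le_total N A with h2 | h2
  · rw [min_eq_left h2]
    linarith [tailProd_le_one hn A]
  · rw [min_eq_right h2]
    linarith [tailProd_le_one hn N]

theorem peakRatio_mem {n : ℕ} (hn : 1 ≤ n) {m : ℕ} (hm : 1 ≤ m) :
    0 ≤ peakRatio n m ∧ peakRatio n m ≤ localDensity n m := by
  have hq := one_sub_mem (temp_pos hn) hm
  have h0 := localDensity_nonneg hn m
  exact ⟨div_nonneg h0 (by linarith [hq.1]), div_le_self h0 (by linarith [hq.1])⟩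

theorem le_level_iff {n : ℕ} (hn : 1 ≤ n) {m : ℕ} (hm : 1 ≤ m) (v : ℝ) :
    m ≤ level n v ↔ m * temp n ≤ center n + v := by
  rw [level, Nat.le_floor_iff' (by omega), le_div_iff₀ (temp_pos hn)]

/-- The Fourier bound needs `m t ≥ 1`. For smaller peaks only `pairProb ≤ 1` is used, and the
resulting loss `1 / (t √t)` is offset later by the tiny mass there. -/
theorem exists_peakRatio_le : ∃ C : ℝ, 0 < C ∧ ∀ n m : ℕ, 1 ≤ n → temp n ≤ 1 → 1 ≤ m →
    peakRatio n m ≤ C + 1 / (temp n * √(temp n)) *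
      (if m ≤ level n (1 - center n) then 1 else 0) := by
  obtain ⟨C, hC, h⟩ := exists_localDensity_le
  refine ⟨C, hC, fun n m hn ht1 hm => (peakRatio_mem hn hm).2.trans ?_⟩
  have ht := temp_pos hn
  have hh : 0 < temp n * √(temp n) := mul_pos ht (Real.sqrt_pos.2 ht)
  split_ifs with h1
  · have h2 : localDensity n m ≤ 1 / (temp n * √(temp n)) := by
      unfold localDensity
      gcongr
      exact pairProb_le_one (Real.exp_pos _) (Real.exp_lt_one_iff.2 (by linarith)) _ _
    linarith
  · rw [mul_zero, add_zero]
    refine h n m hn ht1 ?_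
    rw [le_level_iff hn hm] at h1
    linarith

theorem exists_tendsto_peakRatio : ∃ c : ℝ, 0 < c ∧
    Tendsto (fun p : ℕ × ℕ => peakRatio p.1 p.2) windowFilter (𝓝 c) := by
  obtain ⟨c, hc, h⟩ := exists_tendsto_localDensity
  refine ⟨c / (2 - 0), by linarith, h.div ?_ (by norm_num)⟩
  refine tendsto_const_nhds.sub ?_
  refine squeeze_zero_norm' ?_ (tendsto_exp_center (a := 3 / 4) (by norm_num))
  filter_upwards [eventually_mem_window] with p hp
  rw [Real.norm_of_nonneg (by positivity), ← Real.exp_nat_mul]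
  apply Real.exp_le_exp.2
  linarith [hp.1]

theorem eventually_temp_le_one : ∀ᶠ n in atTop, temp n ≤ 1 :=
  (tendsto_temp.eventually_lt_const zero_lt_one).mono fun _ h => h.le

/-- Weak convergence of the peak weights, uniformly over the cut-off. -/
theorem exists_cumWeight_sub_le : ∃ c : ℝ, 0 < c ∧ ∀ ε : ℝ, 0 < ε → ∀ᶠ n in atTop, ∀ N : ℕ,
    |cumWeight n N - c * tailProd n N| ≤ ε := by
  obtain ⟨c, hc, hlim⟩ := exists_tendsto_peakRatio
  obtain ⟨C, hC, hbound⟩ := exists_peakRatio_le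
  obtain ⟨K, hK, hsmall⟩ := exists_tailProd_level_small
  refine ⟨c, hc, fun ε hε => ?_⟩
  have hw : ∀ᶠ n in atTop, ∀ m, (n, m) ∈ window → |peakRatio n m - c| ≤ ε / 2 := by
    have h1 := hlim.eventually (Metric.closedBall_mem_nhds c (half_pos hε))
    rw [windowFilter, eventually_inf_principal, eventually_comap] at h1
    filter_upwards [h1] with n hn m hm
    exact hn (n, m) rfl hm
  have hb : Tendsto (fun n => (C + 2 * c) * (Real.exp 5 * Real.exp (-(center n / 4)) +
      4 * Real.exp (-center n)) + K * temp n) atTop (𝓝 0) := by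
    have h1 := Real.tendsto_exp_neg_atTop_nhds_zero.comp
      (tendsto_center.atTop_div_const (r := 4) (by norm_num))
    have h2 := Real.tendsto_exp_neg_atTop_nhds_zero.comp tendsto_center
    have h3 := (((h1.const_mul (Real.exp 5)).add (h2.const_mul 4)).const_mul (C + 2 * c)).add
      (tendsto_temp.const_mul K)
    simpa using h3
  filter_upwards [hw, hb.eventually_lt_const (half_pos hε), eventually_ge_atTop 1,
    eventually_temp_le_one, tendsto_center.eventually_ge_atTop 0] with n h1 h2 hn ht1 hL N
  have ht := temp_pos hn
  have hh : 0 < temp n * √(temp n) := mul_pos ht (Real.sqrt_pos.2 ht)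
  -- The levels `A` and `A'` are the edges `3/4 * center n` and `2 * center n` of the window in
  -- terms of `m t`, and `A''` is the edge `m t ≤ 1` below which `peakRatio` has only the trivial
  -- bound.
  set A := level n (-(center n / 4))
  set A' := level n (center n)
  set A'' := level n (1 - center n)
  have hA : tailProd n A ≤ Real.exp 5 * Real.exp (-(center n / 4)) :=
    tailProd_level_le_exp hn ht1 (by linarith)
  have hA' : 1 - tailProd n A' ≤ 4 * Real.exp (-center n) :=
    one_sub_tailProd_level_le hn ht1 hL
  have hA'' := hsmall n hn ht1
  have hpt : ∀ m ∈ Finset.Icc 1 N, |incr n m * peakRatio n m - incr n m * c| ≤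
      ε / 2 * incr n m + (C + c) * (incr n m * (if m ≤ A then 1 else 0)) +
      (C + c) * (incr n m * (if A' < m then 1 else 0)) +
      1 / (temp n * √(temp n)) * (incr n m * (if m ≤ A'' then 1 else 0)) := by
    intro m hm
    have hm1 := (Finset.mem_Icc.1 hm).1
    have hr := peakRatio_mem hn hm1
    have hrb := hbound n m hn ht1 hm1
    have hi := incr_nonneg hn m
    rw [← mul_sub, abs_mul, abs_of_nonneg hi]
    have key : |peakRatio n m - c| ≤ ε / 2 + (C + c) * (if m ≤ A then 1 else 0) +
        (C + c) * (if A' < m then 1 else 0) +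
        1 / (temp n * √(temp n)) * (if m ≤ A'' then 1 else 0) := by
      have p1 : 0 ≤ (C + c) * (if m ≤ A then (1 : ℝ) else 0) := by
        split_ifs <;> linarith
      have p2 : 0 ≤ (C + c) * (if A' < m then (1 : ℝ) else 0) := by
        split_ifs <;> linarith
      have p3 : 0 ≤ 1 / (temp n * √(temp n)) * (if m ≤ A'' then (1 : ℝ) else 0) := by
        refine mul_nonneg (one_div_pos.2 hh).le ?_
        split_ifs <;> norm_num
      by_cases hmw : (n, m) ∈ window
      · linarith [h1 m hmw]
      · have h3 : |peakRatio n m - c| ≤ C + c +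
            1 / (temp n * √(temp n)) * (if m ≤ A'' then 1 else 0) := by
          rw [abs_le]
          constructor <;> linarith [hr.1]
        have h4 : m ≤ A ∨ A' < m := by
          by_contra hcon
          push Not at hcon
          apply hmw
          have h5 := mt (le_level_iff hn hm1 _).2 (not_le.2 hcon.1)
          have h6 := (le_level_iff hn hm1 _).1 hcon.2
          exact ⟨by dsimp only; linarith, by dsimp only; linarith⟩
        rcases h4 with h4 | h4
        · rw [if_pos h4] at p1 ⊢
          linarith
        · rw [if_pos h4] at p2 ⊢
          linarith
    calc incr n m * |peakRatio n m - c| ≤ incr n m * _ := mul_le_mul_of_nonneg_left key hi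
      _ = _ := by ring
  have hsum : |cumWeight n N - c * (tailProd n N - tailProd n 0)| ≤
      ε / 2 + (C + c) * tailProd n A + (C + c) * (1 - tailProd n A') +
        1 / (temp n * √(temp n)) * tailProd n A'' := by
    rw [cumWeight_eq hn, ← sum_incr, mul_comm c, Finset.sum_mul, ← Finset.sum_sub_distrib]
    refine (Finset.abs_sum_le_sum_abs _ _).trans ((Finset.sum_le_sum hpt).trans ?_)
    rw [Finset.sum_add_distrib, Finset.sum_add_distrib, Finset.sum_add_distrib, ← Finset.mul_sum,
      ← Finset.mul_sum, ← Finset.mul_sum, ← Finset.mul_sum, sum_incr]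
    have q1 : tailProd n N - tailProd n 0 ≤ 1 := by
      linarith [tailProd_le_one hn N, tailProd_pos hn 0]
    have q2 := sum_incr_le_tailProd hn N A
    have q3 := sum_incr_gt_le hn N A'
    have q4 := sum_incr_le_tailProd hn N A''
    have q5 : ε / 2 * (tailProd n N - tailProd n 0) ≤ ε / 2 :=
      mul_le_of_le_one_right (by linarith) q1
    gcongr
  -- The increments telescope to `tailProd n N - tailProd n 0`; the last term is absorbed in the
  -- mass below the window.
  have h0 : tailProd n 0 ≤ tailProd n A := tailProd_mono hn (Nat.zero_le _)
  have h00 := tailProd_pos hn 0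
  have hfin : |cumWeight n N - c * tailProd n N| ≤
      |cumWeight n N - c * (tailProd n N - tailProd n 0)| + c * tailProd n 0 := by
    have := abs_sub_le (cumWeight n N) (c * (tailProd n N - tailProd n 0)) (c * tailProd n N)
    have h7 : |c * (tailProd n N - tailProd n 0) - c * tailProd n N| = c * tailProd n 0 := by
      rw [show c * (tailProd n N - tailProd n 0) - c * tailProd n N = -(c * tailProd n 0) by ring,
        abs_neg, abs_of_pos (by positivity)]
    linarith
  have h8 : c * tailProd n 0 ≤ c * tailProd n A := by gcongr
  have h9 : (C + 2 * c) * (tailProd n A + (1 - tailProd n A')) ≤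
      (C + 2 * c) * (Real.exp 5 * Real.exp (-(center n / 4)) + 4 * Real.exp (-center n)) := by
    gcongr
  have h10 : 0 ≤ c * (1 - tailProd n A') :=
    mul_nonneg hc.le (by linarith [tailProd_le_one hn A'])
  nlinarith

theorem cumWeight_mono {n : ℕ} (hn : 1 ≤ n) : Monotone (cumWeight n) := by
  intro a b hab
  refine Finset.sum_le_sum_of_subset_of_nonneg (Finset.Icc_subset_Icc_right hab) fun m _ _ => ?_
  have := normFactor_pos hn
  positivity

theorem cumWeight_eq_min (n N : ℕ) : cumWeight n N = cumWeight n (min n N) := by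
  symm
  refine Finset.sum_subset (Finset.Icc_subset_Icc_right (min_le_right _ _)) fun m hm hm2 => ?_
  rw [Finset.mem_Icc] at hm hm2
  rw [peakCount_eq_zero (Or.inr (by
    by_contra h
    exact hm2 ⟨hm.1, le_min (by omega) hm.2⟩))]
  simp

theorem exists_tail_bounds : ∃ C : ℝ, 0 < C ∧ ∀ᶠ n in atTop, ∀ v : ℝ, 0 ≤ v →
    cumWeight n n - cumWeight n (level n v) ≤ C * Real.exp (-v) ∧
    cumWeight n (level n (-v)) ≤ C * Real.exp (-v) := by
  obtain ⟨C, hC, hbound⟩ := exists_peakRatio_le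
  obtain ⟨K, hK, hsmall⟩ := exists_tailProd_level_small
  -- The upper tail uses `4 * C`. The lower tail uses `C * exp 5` for the bounded part of
  -- `peakRatio` and `2 * K` for the peaks with `m t ≤ 1`.
  refine ⟨4 * C + C * Real.exp 5 + 2 * K, by positivity, ?_⟩
  filter_upwards [eventually_ge_atTop 1, eventually_temp_le_one,
    tendsto_center.eventually_ge_atTop 1] with n hn ht1 hL v hv
  have ht := temp_pos hn
  have hh : 0 < temp n * √(temp n) := mul_pos ht (Real.sqrt_pos.2 ht)
  have hev := Real.exp_pos (-v)
  have e1 : 0 ≤ C * Real.exp 5 * Real.exp (-v) := by positivity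
  have e2 : 0 ≤ K * Real.exp (-v) := by positivity
  have e3 : 0 ≤ C * Real.exp (-v) := by positivity
  constructor
  · have h1 : cumWeight n n - cumWeight n (level n v) ≤
        ∑ m ∈ Finset.Icc 1 n, C * (incr n m * (if level n v < m then 1 else 0)) := by
      rcases le_or_gt n (level n v) with h | h
      · have h2 := cumWeight_mono hn h
        refine (sub_nonpos.2 h2).trans (Finset.sum_nonneg fun m _ => ?_)
        have := incr_nonneg hn m
        split_ifs <;> positivity
      · rw [sub_le_iff_le_add, cumWeight_eq hn, cumWeight_eq hn]
        have h2 : ∑ m ∈ Finset.Icc 1 (level n v), incr n m * peakRatio n m =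
            ∑ m ∈ Finset.Icc 1 n, incr n m * peakRatio n m *
              (if m ≤ level n v then 1 else 0) := by
          simp_rw [mul_ite, mul_one, mul_zero]
          rw [← Finset.sum_filter]
          refine Finset.sum_congr ?_ fun _ _ => rfl
          ext m
          simp only [Finset.mem_filter, Finset.mem_Icc]
          omega
        rw [h2, ← Finset.sum_add_distrib]
        refine Finset.sum_le_sum fun m hm => ?_
        have hm1 := (Finset.mem_Icc.1 hm).1
        have hi := incr_nonneg hn m
        rcases le_or_gt m (level n v) with h3 | h3
        · rw [if_neg (by omega), if_pos h3]
          linarith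
        · rw [if_pos h3, if_neg (by omega)]
          have h4 := hbound n m hn ht1 hm1
          rw [if_neg] at h4
          · nlinarith
          · rw [le_level_iff hn hm1]
            have h5 := mt (le_level_iff hn hm1 _).2 (not_le.2 h3)
            linarith
    rw [← Finset.mul_sum] at h1
    have h2 := sum_incr_gt_le hn n (level n v)
    have h3 := one_sub_tailProd_level_le hn ht1 hv
    have h4 : C * ∑ m ∈ Finset.Icc 1 n, incr n m * (if level n v < m then 1 else 0) ≤
        C * (4 * Real.exp (-v)) := by
      gcongr
      linarith
    linarith
  -- For `v > center n` the level is the floor of a negative number, hence `0`, and the sum is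
  -- empty. Otherwise `t = 2 exp (-center n) ≤ 2 exp (-v)`.
  · rcases lt_or_ge (center n) v with h | h
    · have h1 : level n (-v) = 0 := by
        rw [level, Nat.floor_eq_zero, div_lt_one ht]
        linarith
      rw [h1]
      have h2 : cumWeight n 0 = 0 := by simp [cumWeight]
      rw [h2]
      positivity
    · have h1 : cumWeight n (level n (-v)) ≤ ∑ m ∈ Finset.Icc 1 (level n (-v)),
          (C * incr n m + 1 / (temp n * √(temp n)) *
            (incr n m * (if m ≤ level n (1 - center n) then 1 else 0))) := by
        rw [cumWeight_eq hn]
        refine Finset.sum_le_sum fun m hm => ?_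
        have hm1 := (Finset.mem_Icc.1 hm).1
        calc incr n m * peakRatio n m ≤ incr n m * _ :=
              mul_le_mul_of_nonneg_left (hbound n m hn ht1 hm1) (incr_nonneg hn m)
          _ = _ := by ring
      rw [Finset.sum_add_distrib, ← Finset.mul_sum, ← Finset.mul_sum, sum_incr] at h1
      have h2 := sum_incr_le_tailProd hn (level n (-v)) (level n (1 - center n))
      have h3 := tailProd_level_le_exp hn ht1 (v := -v) (by linarith)
      have h4 := hsmall n hn ht1
      have h5 : temp n ≤ 2 * Real.exp (-v) := by
        have h6 := exp_neg_center hn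
        have h7 : Real.exp (-center n) ≤ Real.exp (-v) := Real.exp_le_exp.2 (by linarith)
        linarith
      have h6 : 1 / (temp n * √(temp n)) * ∑ m ∈ Finset.Icc 1 (level n (-v)),
          incr n m * (if m ≤ level n (1 - center n) then 1 else 0) ≤ K * (2 * Real.exp (-v)) := by
        calc _ ≤ 1 / (temp n * √(temp n)) * tailProd n (level n (1 - center n)) := by gcongr
          _ ≤ K * temp n := h4
          _ ≤ _ := by gcongr
      have h7 : C * (tailProd n (level n (-v)) - tailProd n 0) ≤
          C * (Real.exp 5 * Real.exp (-v)) := by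
        gcongr
        linarith [tailProd_pos hn 0]
      linarith

/-- Uniformity in the cut-off allows it to vary with `n`: `N = n` gives the total mass `c`, and `N =
level n v` gives the Gumbel limit times `c`. -/
theorem tendsto_cumWeight_self : ∃ c : ℝ, 0 < c ∧ Tendsto (fun n => cumWeight n n) atTop (𝓝 c) ∧
    ∀ v : ℝ, Tendsto (fun n => cumWeight n (level n v)) atTop
      (𝓝 (c * Real.exp (-Real.exp (-v)))) := by
  obtain ⟨c, hc, h⟩ := exists_cumWeight_sub_le
  have key : ∀ N : ℕ → ℕ,
      Tendsto (fun n => cumWeight n (N n) - c * tailProd n (N n)) atTop (𝓝 0) := by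
    intro N
    rw [Metric.tendsto_atTop']
    intro ε hε
    obtain ⟨a, ha⟩ := eventually_atTop.1 (h (ε / 2) (half_pos hε))
    refine ⟨a, fun n hn => ?_⟩
    rw [Real.dist_eq, sub_zero]
    linarith [ha n hn.le (N n)]
  refine ⟨c, hc, ?_, fun v => ?_⟩
  · have h1 := (key fun n => n).add_const c
    simp only [tailProd_of_le le_rfl] at h1
    simpa using h1
  · have h1 := (key fun n => level n v).add ((tendsto_tailProd_level v).const_mul c)
    simpa using h1

/-! ### The limit law of the peak -/

/-- The normalised peak. -/
noncomputable def normPeak (n : ℕ) (l : UnimodalSeq) : ℝ := PK l * temp n - center n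

theorem sum_peakCount_filter (n N : ℕ) (hn : 1 ≤ n) :
    (∑ m ∈ (Finset.Icc 1 n).filter (· ≤ N), (peakCount n m : ℝ)) =
      cumWeight n N / normFactor n := by
  rw [cumWeight_eq_min, cumWeight, ← Finset.sum_mul, mul_div_cancel_right₀ _ (normFactor_pos hn).ne']
  refine Finset.sum_congr ?_ fun _ _ => rfl
  ext m
  simp only [Finset.mem_filter, Finset.mem_Icc, le_min_iff]
  omega

theorem unif_real_normPeak_le {n : ℕ} (hn : 1 ≤ n) (v : ℝ) :
    (unif n).real {l | normPeak n l ≤ v} = cumWeight n (level n v) / cumWeight n n := by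
  have h1 : {l | normPeak n l ≤ v} = {l : UnimodalSeq | l.peak ≤ level n v} := by
    ext l
    simp only [Set.mem_ofPred_eq]
    rw [le_level_iff hn l.peak_pos, normPeak, PK]
    constructor <;> intro h <;> linarith
  rw [h1, unif_real_peak (fun m => m ≤ level n v)]
  have h2 := sum_peakCount_filter n (level n v) hn
  have h3 := sum_peakCount_filter n n hn
  have h4 : (Finset.Icc 1 n).filter (· ≤ n) = Finset.Icc 1 n :=
    Finset.filter_true_of_mem fun m hm => (Finset.mem_Icc.1 hm).2
  rw [h4] at h3
  rw [h3, div_div_eq_mul_div]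
  have h5 := congrArg (· * normFactor n / cumWeight n n) h2
  rw [div_mul_cancel₀ _ (normFactor_pos hn).ne'] at h5
  convert h5

theorem tendsto_unif_normPeak (v : ℝ) :
    Tendsto (fun n => (unif n).real {l | normPeak n l ≤ v}) atTop
      (𝓝 (Real.exp (-Real.exp (-v)))) := by
  obtain ⟨c, hc, h1, h2⟩ := tendsto_cumWeight_self
  have h3 := (h2 v).div h1 hc.ne'
  rw [mul_div_cancel_left₀ _ hc.ne'] at h3
  refine h3.congr' ?_
  filter_upwards [eventually_ge_atTop 1] with n hn
  exact (unif_real_normPeak_le hn v).symm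

/-! ### Convergence of the mean -/

/-- Layer-cake formula for real-valued random variables. -/
theorem integral_eq_integral_tails {Ω : Type*} [MeasurableSpace Ω] {μ : Measure Ω} {Y : Ω → ℝ}
    (hY : Integrable Y μ) :
    ∫ ω, Y ω ∂μ = (∫ v in Set.Ioi (0 : ℝ), μ.real {ω | v < Y ω}) -
      ∫ v in Set.Ioi (0 : ℝ), μ.real {ω | Y ω ≤ -v} := by
  have h1 := hY.pos_part.integral_eq_integral_meas_lt (ae_of_all _ fun ω => le_max_right _ _)
  have h2 := hY.neg_part.integral_eq_integral_meas_le (ae_of_all _ fun ω => le_max_right _ _)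
  have h3 : ∫ ω, Y ω ∂μ = (∫ ω, max (Y ω) 0 ∂μ) - ∫ ω, max (-Y ω) 0 ∂μ := by
    rw [← integral_sub hY.pos_part hY.neg_part]
    refine integral_congr_ae (ae_of_all _ fun ω => ?_)
    dsimp only
    rcases le_total 0 (Y ω) with h | h
    · rw [max_eq_left h, max_eq_right (by linarith), sub_zero]
    · rw [max_eq_right h, max_eq_left (by linarith)]; ring
  rw [h3, h1, h2]
  congr 1
  · refine setIntegral_congr_fun measurableSet_Ioi fun v hv => ?_
    rw [Set.mem_Ioi] at hv
    congr 1
    ext ω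
    simp [not_lt.2 hv.le]
  · refine setIntegral_congr_fun measurableSet_Ioi fun v hv => ?_
    rw [Set.mem_Ioi] at hv
    congr 1
    ext ω
    simp only [Set.mem_ofPred_eq, le_max_iff, not_le.2 hv, or_false]
    constructor <;> intro h <;> linarith

/-- The integral is the derivative of the Gamma integral at `1`, and `Γ'(1) = -γ`. -/
theorem integral_log_mul_exp_neg :
    ∫ x in Set.Ioi (0 : ℝ), Real.log x * Real.exp (-x) = -Real.eulerMascheroniConstant := by
  have h1 := Complex.hasDerivAt_GammaIntegral (s := 1) (by simp)
  have h2 : HasDerivAt Complex.GammaIntegral (-(Real.eulerMascheroniConstant : ℂ)) 1 := by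
    refine Complex.hasDerivAt_Gamma_one.congr_of_eventuallyEq ?_
    have : ∀ᶠ s : ℂ in 𝓝 1, 0 < s.re :=
      Complex.continuous_re.continuousAt.eventually (lt_mem_nhds (by simp))
    filter_upwards [this] with s hs
    exact (Complex.Gamma_eq_integral hs).symm
  have h3 := h1.unique h2
  have h4 : ∫ t : ℝ in Set.Ioi 0, (t : ℂ) ^ ((1 : ℂ) - 1) * (Real.log t * Real.exp (-t)) =
      ((∫ x in Set.Ioi (0 : ℝ), Real.log x * Real.exp (-x) : ℝ) : ℂ) := by
    rw [← integral_complex_ofReal]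
    refine integral_congr_ae (ae_of_all _ fun x => ?_)
    simp
  rw [h4] at h3
  exact_mod_cast h3

/-- The standard exponential law. -/
noncomputable def stdExp : Measure ℝ :=
  (volume.restrict (Set.Ioi 0)).withDensity fun x => ENNReal.ofReal (Real.exp (-x))

theorem stdExp_Ici {a : ℝ} (ha : 0 < a) : stdExp (Set.Ici a) = ENNReal.ofReal (Real.exp (-a)) := by
  rw [stdExp, withDensity_apply _ measurableSet_Ici, Measure.restrict_restrict measurableSet_Ici,
    Set.inter_eq_left.2 (Set.Ici_subset_Ioi.2 ha), ← ofReal_integral_eq_lintegral_ofReal,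
    integral_Ici_eq_integral_Ioi, integral_exp_neg_Ioi]
  · rw [← IntegrableOn, integrableOn_Ici_iff_integrableOn_Ioi]
    simpa using exp_neg_integrableOn_Ioi a one_pos
  · exact ae_of_all _ fun x => (Real.exp_pos _).le

instance : IsProbabilityMeasure stdExp := by
  refine ⟨?_⟩
  rw [stdExp, withDensity_apply _ MeasurableSet.univ, Measure.restrict_univ,
    ← ofReal_integral_eq_lintegral_ofReal, integral_exp_neg_Ioi_zero, ENNReal.ofReal_one]
  · have := exp_neg_integrableOn_Ioi 0 one_pos
    simp only [neg_mul, one_mul] at this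
    exact this
  · exact ae_of_all _ fun x => (Real.exp_pos _).le

theorem ae_pos_stdExp : ∀ᵐ x ∂stdExp, 0 < x :=
  (withDensity_absolutelyContinuous _ _).ae_le (ae_restrict_mem measurableSet_Ioi)

theorem integral_stdExp (g : ℝ → ℝ) :
    ∫ x, g x ∂stdExp = ∫ x in Set.Ioi (0 : ℝ), g x * Real.exp (-x) := by
  rw [stdExp, integral_withDensity_eq_integral_toReal_smul (by fun_prop)
    (ae_of_all _ fun _ => ENNReal.ofReal_lt_top)]
  refine integral_congr_ae (ae_of_all _ fun x => ?_)
  dsimp only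
  rw [ENNReal.toReal_ofReal (Real.exp_pos _).le, smul_eq_mul, mul_comm]

theorem eulerMascheroniConstant_pos : 0 < Real.eulerMascheroniConstant :=
  lt_trans (by norm_num) Real.one_half_lt_eulerMascheroniConstant

theorem integral_neg_log_stdExp :
    ∫ x, -Real.log x ∂stdExp = Real.eulerMascheroniConstant := by
  rw [integral_neg, integral_stdExp, integral_log_mul_exp_neg, neg_neg]

theorem integrable_neg_log_stdExp : Integrable (fun x => -Real.log x) stdExp := by
  -- A non-integrable function has integral `0` by convention, whereas this integral is `γ > 0`.
  by_contra h
  have h1 := integral_neg_log_stdExp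
  rw [integral_undef h] at h1
  exact eulerMascheroniConstant_pos.ne h1

/-- The mean of the Gumbel law is the Euler-Mascheroni constant. -/
theorem eulerMascheroniConstant_eq_integral_tails :
    (∫ v in Set.Ioi (0 : ℝ), (1 - Real.exp (-Real.exp (-v)))) -
      ∫ v in Set.Ioi (0 : ℝ), Real.exp (-Real.exp v) = Real.eulerMascheroniConstant := by
  rw [← integral_neg_log_stdExp, integral_eq_integral_tails integrable_neg_log_stdExp]
  -- If `X` is standard exponential, then `-log X` is Gumbel: the event `-log X ≤ v` is `X ≥ exp
  -- (-v)`.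
  have hIci : ∀ v : ℝ, stdExp.real (Set.Ici (Real.exp v)) = Real.exp (-Real.exp v) := fun v => by
    rw [Measure.real, stdExp_Ici (Real.exp_pos v), ENNReal.toReal_ofReal (Real.exp_pos _).le]
  congr 1
  · congr 1
    ext v
    rw [← hIci, ← probReal_compl_eq_one_sub measurableSet_Ici]
    refine measureReal_congr ?_
    filter_upwards [ae_pos_stdExp] with x hx
    refine propext ?_
    change x ∈ (Set.Ici (Real.exp (-v)))ᶜ ↔ v < -Real.log x
    rw [Set.compl_Ici, Set.mem_Iio, ← Real.log_lt_iff_lt_exp hx]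
    constructor <;> intro h <;> linarith
  · congr 1
    ext v
    rw [← hIci]
    refine measureReal_congr ?_
    filter_upwards [ae_pos_stdExp] with x hx
    refine propext ?_
    change x ∈ Set.Ici (Real.exp v) ↔ -Real.log x ≤ -v
    rw [Set.mem_Ici, ← Real.le_log_iff_exp_le hx, neg_le_neg_iff]

theorem ae_peak_le (n : ℕ) : ∀ᵐ l ∂(unif n), l.peak ≤ n := by
  have hs : MeasurableSet (ofSize n) := trivial
  have h : ∀ᵐ l ∂(unif n), l ∈ ofSize n := by
    unfold unif ProbabilityTheory.uniformOn
    exact ProbabilityTheory.ae_cond_mem hs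
  filter_upwards [h] with l hl
  have hl' : l.left.sum + l.peak + l.right.sum = n := hl
  omega

theorem integrable_PK {n : ℕ} (hn : 1 ≤ n) : Integrable PK (unif n) := by
  have := isProbabilityMeasure_unif hn
  refine Integrable.of_bound (C := n) measurable_from_top.aestronglyMeasurable ?_
  filter_upwards [ae_peak_le n] with l hl
  rw [PK, Real.norm_natCast]
  exact_mod_cast hl

theorem integrable_normPeak {n : ℕ} (hn : 1 ≤ n) : Integrable (normPeak n) (unif n) := by
  have := isProbabilityMeasure_unif hn
  exact ((integrable_PK hn).mul_const _).sub (integrable_const _)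

theorem unif_real_lt_normPeak {n : ℕ} (hn : 1 ≤ n) (v : ℝ) :
    (unif n).real {l | v < normPeak n l} = 1 - (unif n).real {l | normPeak n l ≤ v} := by
  have := isProbabilityMeasure_unif hn
  have h : MeasurableSet {l | normPeak n l ≤ v} := trivial
  rw [← probReal_compl_eq_one_sub h]
  congr 1
  ext l
  simp

theorem exists_normPeak_tail_le : ∃ C : ℝ, 0 < C ∧ ∀ᶠ n in atTop, ∀ v : ℝ, 0 ≤ v →
    (unif n).real {l | v < normPeak n l} ≤ C * Real.exp (-v) ∧
    (unif n).real {l | normPeak n l ≤ -v} ≤ C * Real.exp (-v) := by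
  obtain ⟨C, hC, h⟩ := exists_tail_bounds
  obtain ⟨c, hc, hc2, _⟩ := tendsto_cumWeight_self
  refine ⟨C / (c / 2), by positivity, ?_⟩
  filter_upwards [h, eventually_ge_atTop 1, hc2.eventually_const_lt (half_lt_self hc)]
    with n h1 hn h2 v hv
  have h3 : 0 < cumWeight n n := lt_trans (by positivity) h2
  obtain ⟨h4, h5⟩ := h1 v hv
  have hev := Real.exp_pos (-v)
  have h6 : C * Real.exp (-v) / cumWeight n n ≤ C / (c / 2) * Real.exp (-v) := by
    rw [div_mul_eq_mul_div]
    gcongr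
  constructor
  · rw [unif_real_lt_normPeak hn, unif_real_normPeak_le hn, one_sub_div h3.ne']
    refine le_trans ?_ h6
    gcongr
  · rw [unif_real_normPeak_le hn]
    refine le_trans ?_ h6
    gcongr

/-- Convergence in law alone does not give the mean. The exponential tail bounds, uniform in large
`n`, dominate both layer-cake integrals, whose limits are those of the Gumbel law. -/
theorem tendsto_integral_normPeak :
    Tendsto (fun n => ∫ l, normPeak n l ∂(unif n)) atTop (𝓝 Real.eulerMascheroniConstant) := by
  obtain ⟨C, hC, h⟩ := exists_normPeak_tail_le
  have hint : IntegrableOn (fun v : ℝ => C * Real.exp (-v)) (Set.Ioi 0) := by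
    have h0 := exp_neg_integrableOn_Ioi 0 one_pos
    simp only [neg_mul, one_mul] at h0
    exact h0.const_mul C
  have hfin : ∀ n, 1 ≤ n → IsProbabilityMeasure (unif n) := fun n => isProbabilityMeasure_unif
  have h1 : Tendsto (fun n => ∫ v in Set.Ioi (0 : ℝ), (unif n).real {l | v < normPeak n l}) atTop
      (𝓝 (∫ v in Set.Ioi (0 : ℝ), (1 - Real.exp (-Real.exp (-v))))) := by
    refine tendsto_integral_filter_of_dominated_convergence _ ?_ ?_ hint ?_
    · filter_upwards [eventually_ge_atTop 1] with n hn
      have := hfin n hn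
      refine Measurable.aestronglyMeasurable (Antitone.measurable fun a b hab => ?_)
      exact measureReal_mono fun l hl => lt_of_le_of_lt hab hl
    · filter_upwards [h] with n hn
      refine (ae_restrict_mem measurableSet_Ioi).mono fun v hv => ?_
      rw [Real.norm_of_nonneg measureReal_nonneg]
      exact (hn v (le_of_lt hv)).1
    · refine ae_of_all _ fun v => ?_
      refine (tendsto_const_nhds.sub (tendsto_unif_normPeak v)).congr' ?_
      filter_upwards [eventually_ge_atTop 1] with n hn
      exact (unif_real_lt_normPeak hn v).symm
  have h2 : Tendsto (fun n => ∫ v in Set.Ioi (0 : ℝ), (unif n).real {l | normPeak n l ≤ -v}) atTop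
      (𝓝 (∫ v in Set.Ioi (0 : ℝ), Real.exp (-Real.exp v))) := by
    refine tendsto_integral_filter_of_dominated_convergence _ ?_ ?_ hint ?_
    · filter_upwards [eventually_ge_atTop 1] with n hn
      have := hfin n hn
      refine Measurable.aestronglyMeasurable (Antitone.measurable fun a b hab => ?_)
      refine measureReal_mono fun l hl => ?_
      simp only [Set.mem_ofPred_eq] at hl ⊢
      linarith
    · filter_upwards [h] with n hn
      refine (ae_restrict_mem measurableSet_Ioi).mono fun v hv => ?_
      rw [Real.norm_of_nonneg measureReal_nonneg]
      exact (hn v (le_of_lt hv)).2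
    · refine ae_of_all _ fun v => ?_
      simpa using tendsto_unif_normPeak (-v)
  rw [← eulerMascheroniConstant_eq_integral_tails]
  refine (h1.sub h2).congr' ?_
  filter_upwards [eventually_ge_atTop 1] with n hn
  exact (integral_eq_integral_tails (integrable_normPeak hn)).symm

theorem normPeak_eq {n : ℕ} (hn : 1 ≤ n) (l : UnimodalSeq) :
    (PK l - B * √(n : ℝ) * Real.log (2 * B * √(n : ℝ))) / (B * √(n : ℝ)) = normPeak n l := by
  have h0 : (0 : ℝ) < n := by exact_mod_cast hn
  have := B_pos
  rw [normPeak, temp, center]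
  field_simp

theorem integral_PK_eq {n : ℕ} (hn : 1 ≤ n) :
    ∫ l, PK l ∂(unif n) = B * √(n : ℝ) * Real.log (2 * B * √(n : ℝ)) +
      B * √(n : ℝ) * ∫ l, normPeak n l ∂(unif n) := by
  have := isProbabilityMeasure_unif hn
  have h0 : (0 : ℝ) < n := by exact_mod_cast hn
  have hB := B_pos
  have h1 : ∫ l, normPeak n l ∂(unif n) = (∫ l, PK l ∂(unif n)) * temp n - center n := by
    unfold normPeak
    rw [integral_sub ((integrable_PK hn).mul_const _) (integrable_const _), integral_mul_const]
    simp
  rw [h1, temp, center]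
  field_simp
  ring

end UnimodalSeq

theorem theorem1p3 :
    (∀ v : ℝ, Tendsto
      (fun n : ℕ => (UnimodalSeq.unif n).real
        {l | (UnimodalSeq.PK l - UnimodalSeq.B * √(n : ℝ) * Real.log (2 * UnimodalSeq.B * √(n : ℝ)))
              / (UnimodalSeq.B * √(n : ℝ)) ≤ v})
      atTop (𝓝 (Real.exp (-Real.exp (-v))))) ∧
    (∃ ε : ℕ → ℝ, Tendsto ε atTop (𝓝 0) ∧ ∀ n : ℕ, 1 ≤ n →
      ∫ l, UnimodalSeq.PK l ∂(UnimodalSeq.unif n) =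
        UnimodalSeq.B * √(n : ℝ) * Real.log (2 * UnimodalSeq.B * √(n : ℝ))
          + UnimodalSeq.B * Real.eulerMascheroniConstant * √(n : ℝ) * (1 + ε n)) := by
  refine ⟨fun v => ?_, ?_⟩
  · refine (UnimodalSeq.tendsto_unif_normPeak v).congr' ?_
    filter_upwards [eventually_ge_atTop 1] with n hn
    simp_rw [UnimodalSeq.normPeak_eq hn]
  · have hγ := UnimodalSeq.eulerMascheroniConstant_pos.ne'
    -- The relative error is forced by `integral_PK_eq`; dividing by `γ` is legitimate because `γ ≠
    -- 0`.
    refine ⟨fun n => (∫ l, UnimodalSeq.normPeak n l ∂(UnimodalSeq.unif n)) /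
      Real.eulerMascheroniConstant - 1, ?_, fun n hn => ?_⟩
    · have h := (UnimodalSeq.tendsto_integral_normPeak.div_const
        Real.eulerMascheroniConstant).sub_const 1
      rwa [div_self hγ, sub_self] at h
    · rw [UnimodalSeq.integral_PK_eq hn]
      field_simp
      ring
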